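/- Let $\rho(y)=y^2e^{-y^2/4}$ for $y>0$, and let $f_0\in C^\infty([0,\infty))$ be any real-valued solution of the boundary value problem \[ f''(y)+\Big(\frac{2}{y}-\frac{y}{2}\Big)f'(y)-\frac{\sin(2f(y))}{y^2}=0\quad (y>0),\qquad f(0)=0,\qquad \lim_{y\to\infty}f(y)\ \text{exists in } \mathbb R . \] On the complex Hilbert space $\mathcal H=L^2_\rho(0,\infty)=L^2((0,\infty),\rho(y)\,dy)$ consider the operator \[ \mathcal A_0w(y)=-\frac{1}{\rho(y)}\,\partial_y\big[\rho(y)\,\partial_yw(y)\big]+\frac{2\cos(2f_0(y))}{y^2}\,w(y) \] with domain $C_0^\infty(0,\infty)$, the smooth complex-valued functions with compact support in $(0,\infty)$. Then $\mathcal A_0$ is essentially self-adjoint, that is, it is densely defined, symmetric and closable, and its closure is self-adjoint. The spectrum of the closure is purely discrete (every point of it is an isolated point of the spectrum and an eigenvalue of finite multiplicity), it is a countably infinite set, and each of its points is real and is a simple eigenvalue (its eigenspace is one-dimensional). -/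

import Mathlib

open Set Filter Topology MeasureTheory TopologicalSpace
open scoped ENNReal ContDiff Distributions InnerProductSpace

namespace HarmonicMapFlow

/-- `f ∈ C^∞([0,∞))` solves the boundary value problem
`f'' + (2/y - y/2) f' - sin(2f)/y² = 0` for `y > 0`, `f(0) = 0`, `f(∞) = const`.
Only the values of `f` on `[0,∞)` matter. -/
structure IsSelfSimilarProfile (f : ℝ → ℝ) : Prop where
  smooth : ContDiffOn ℝ ∞ f (Ici 0)
  ode : ∀ y : ℝ, 0 < y →
    deriv (deriv f) y + (2 / y - y / 2) * deriv f y - 1 / y ^ 2 * Real.sin (2 * f y) = 0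
  at_zero : f 0 = 0
  at_infinity : ∃ c : ℝ, Tendsto f atTop (𝓝 c)

/-- The weight `ρ(y) = y² e^{-y²/4}`. -/
noncomputable def rho (y : ℝ) : ℝ := y ^ 2 * Real.exp (-(y ^ 2 / 4))

/-- The measure `ρ(y) dy` on `(0,∞)`. -/
noncomputable def rhoMeasure : Measure ℝ :=
  (volume.restrict (Ioi (0 : ℝ))).withDensity fun y => ENNReal.ofReal (rho y)

/-- The (complex) Hilbert space `L²_ρ(0,∞)`. -/
abbrev WeightedL2 : Type := Lp ℂ 2 rhoMeasure

/-- The half-line `(0,∞)` as an open set. -/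
def halfLine : Opens ℝ := ⟨Ioi 0, isOpen_Ioi⟩

/-- The differential expression `-(1/ρ) (ρ w')' + (2 cos(2 f) / y²) w`. -/
noncomputable def formalOp (f : ℝ → ℝ) (w : ℝ → ℂ) (y : ℝ) : ℂ :=
  -((1 / rho y) • deriv (fun x => rho x • deriv w x) y)
    + (2 * Real.cos (2 * f y) / y ^ 2) • w y

theorem contDiff_rho : ContDiff ℝ ∞ rho := by
  unfold rho; fun_prop

theorem continuous_rho : Continuous rho := contDiff_rho.continuous

theorem rho_pos {y : ℝ} (hy : 0 < y) : 0 < rho y := by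
  unfold rho; positivity

instance : IsLocallyFiniteMeasure rhoMeasure :=
  IsLocallyFiniteMeasure.withDensity_ofReal continuous_rho

theorem contDiff_deriv_test (φ : 𝓓(halfLine, ℂ)) : ContDiff ℝ ∞ (deriv φ) :=
  (contDiff_infty_iff_deriv.1 φ.contDiff).2

theorem contDiff_rho_deriv (φ : 𝓓(halfLine, ℂ)) :
    ContDiff ℝ ∞ (fun x => rho x • deriv φ x) :=
  contDiff_rho.smul (contDiff_deriv_test φ)

theorem formalOp_eventually_zero (f : ℝ → ℝ) (φ : 𝓓(halfLine, ℂ)) {y : ℝ}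
    (hy : y ∉ tsupport φ) : formalOp f φ =ᶠ[𝓝 y] 0 := by
  have h0 : ∀ᶠ x in 𝓝 y, (φ : ℝ → ℂ) =ᶠ[𝓝 x] 0 :=
    (notMem_tsupport_iff_eventuallyEq.1 hy).eventuallyEq_nhds
  have h1 : ∀ᶠ x in 𝓝 y, deriv φ x = 0 := by
    filter_upwards [h0] with x hx
    rw [hx.deriv_eq]; simp
  have h2 : ∀ᶠ x in 𝓝 y, ∀ᶠ z in 𝓝 x, deriv φ z = 0 := h1.eventually_nhds
  filter_upwards [h0, h2] with x hx hx2
  have h3 : (fun z => rho z • deriv φ z) =ᶠ[𝓝 x] fun _ => 0 := by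
    filter_upwards [hx2] with z hz
    simp [hz]
  unfold formalOp
  rw [h3.deriv_eq, hx.eq_of_nhds]
  simp

theorem continuous_formalOp {f : ℝ → ℝ} (hf : IsSelfSimilarProfile f) (φ : 𝓓(halfLine, ℂ)) :
    Continuous (formalOp f φ) := by
  rw [continuous_iff_continuousAt]
  intro y
  by_cases hy : y ∈ tsupport φ
  · have hy0 : 0 < y := φ.tsupport_subset hy
    have hfy : ContinuousAt f y :=
      (hf.smooth.continuousOn).continuousAt (Ici_mem_nhds hy0)
    have h1 : ContinuousAt (deriv (fun x => rho x • deriv φ x)) y :=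
      ((contDiff_infty_iff_deriv.1 (contDiff_rho_deriv φ)).2).continuous.continuousAt
    have h2 : ContinuousAt rho y := continuous_rho.continuousAt
    have h3 : ContinuousAt φ y := φ.continuous.continuousAt
    have h4 : rho y ≠ 0 := (rho_pos hy0).ne'
    have h5 : y ^ 2 ≠ 0 := by positivity
    unfold formalOp
    have h6 : ContinuousAt (fun y => 1 / rho y) y := continuousAt_const.div h2 h4
    have h7 : ContinuousAt (fun y => 2 * Real.cos (2 * f y) / y ^ 2) y :=
      ContinuousAt.div (continuousAt_const.mul
        (Real.continuous_cos.continuousAt.comp (continuousAt_const.mul hfy))) (by fun_prop) h5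
    exact (h6.smul h1).neg.add (h7.smul h3)
  · exact (continuousAt_const (y := (0 : ℂ))).congr (formalOp_eventually_zero f φ hy).symm

theorem hasCompactSupport_formalOp (f : ℝ → ℝ) (φ : 𝓓(halfLine, ℂ)) :
    HasCompactSupport (formalOp f φ) := by
  refine HasCompactSupport.intro φ.hasCompactSupport fun y hy => ?_
  exact (formalOp_eventually_zero f φ hy).eq_of_nhds

theorem memLp_test (φ : 𝓓(halfLine, ℂ)) : MemLp φ 2 rhoMeasure :=
  φ.continuous.memLp_of_hasCompactSupport φ.hasCompactSupport

theorem memLp_formalOp {f : ℝ → ℝ} (hf : IsSelfSimilarProfile f) (φ : 𝓓(halfLine, ℂ)) :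
    MemLp (formalOp f φ) 2 rhoMeasure :=
  (continuous_formalOp hf φ).memLp_of_hasCompactSupport (hasCompactSupport_formalOp f φ)

/-- The embedding of `C_0^∞(0,∞)` into `L²_ρ(0,∞)`. -/
noncomputable def testToL2 : 𝓓(halfLine, ℂ) →ₗ[ℂ] WeightedL2 where
  toFun φ := (memLp_test φ).toLp φ
  map_add' φ ψ := (memLp_test φ).toLp_add (memLp_test ψ)
  map_smul' c φ := (memLp_test φ).toLp_const_smul c

theorem formalOp_add (f : ℝ → ℝ) (φ ψ : 𝓓(halfLine, ℂ)) :
    formalOp f ⇑(φ + ψ) = formalOp f φ + formalOp f ψ := by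
  have hd : ∀ χ : 𝓓(halfLine, ℂ), Differentiable ℝ χ := fun χ =>
    χ.contDiff.differentiable (by simp)
  have hd2 : ∀ χ : 𝓓(halfLine, ℂ), Differentiable ℝ (fun x => rho x • deriv χ x) := fun χ =>
    (contDiff_rho_deriv χ).differentiable (by simp)
  have h1 : (fun x => rho x • deriv (⇑(φ + ψ)) x)
      = (fun x => rho x • deriv φ x) + fun x => rho x • deriv ψ x := by
    funext x
    have : (⇑(φ + ψ) : ℝ → ℂ) = ⇑φ + ⇑ψ := rfl
    rw [this, deriv_add (hd φ x) (hd ψ x), smul_add]; rfl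
  funext y
  have h2 : (φ + ψ) y = φ y + ψ y := rfl
  simp only [formalOp, h1, Pi.add_apply, h2]
  rw [deriv_add (hd2 φ y) (hd2 ψ y), smul_add, smul_add]
  abel

theorem formalOp_smul (f : ℝ → ℝ) (c : ℂ) (φ : 𝓓(halfLine, ℂ)) :
    formalOp f ⇑(c • φ) = c • formalOp f φ := by
  have hd : Differentiable ℝ φ := φ.contDiff.differentiable (by simp)
  have hd2 : Differentiable ℝ (fun x => rho x • deriv φ x) :=
    (contDiff_rho_deriv φ).differentiable (by simp)
  have h1 : (fun x => rho x • deriv (⇑(c • φ)) x) = c • fun x => rho x • deriv φ x := by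
    funext x
    have : (⇑(c • φ) : ℝ → ℂ) = c • ⇑φ := rfl
    rw [this, deriv_const_smul c (hd x), smul_comm]; rfl
  funext y
  have h2 : (c • φ) y = c • φ y := rfl
  simp only [formalOp, h1, Pi.smul_apply, h2]
  rw [deriv_const_smul c (hd2 y), smul_comm _ c, smul_comm _ c, smul_add, smul_neg]

/-- The map `φ ↦ 𝒜₀ φ` from `C_0^∞(0,∞)` to `L²_ρ(0,∞)`. -/
noncomputable def formalOpToL2 (f : ℝ → ℝ) (hf : IsSelfSimilarProfile f) :
    𝓓(halfLine, ℂ) →ₗ[ℂ] WeightedL2 where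
  toFun φ := (memLp_formalOp hf φ).toLp (formalOp f φ)
  map_add' φ ψ := by
    rw [← MemLp.toLp_add]
    exact MemLp.toLp_congr _ _ (by rw [formalOp_add])
  map_smul' c φ := by
    rw [RingHom.id_apply, ← MemLp.toLp_const_smul]
    exact MemLp.toLp_congr _ _ (by rw [formalOp_smul])

theorem testToL2_injective : Function.Injective testToL2 := by
  intro φ ψ h
  have h1 : (φ : ℝ → ℂ) =ᵐ[rhoMeasure] ψ :=
    (MemLp.toLp_eq_toLp_iff (memLp_test φ) (memLp_test ψ)).1 h
  have h2 : (φ : ℝ → ℂ) =ᵐ[volume.restrict (Ioi (0 : ℝ))] ψ := by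
    have h3 := (ae_withDensity_iff
      (continuous_rho.measurable.ennreal_ofReal)).1 h1
    filter_upwards [h3, ae_restrict_mem measurableSet_Ioi] with x hx hx0
    exact hx (by simpa using rho_pos hx0)
  have h4 : EqOn (φ : ℝ → ℂ) ψ (Ioi 0) :=
    Measure.eqOn_open_of_ae_eq h2 isOpen_Ioi φ.continuous.continuousOn ψ.continuous.continuousOn
  have h5 : ∀ (χ : 𝓓(halfLine, ℂ)) (x : ℝ), x ∉ Ioi (0 : ℝ) → χ x = 0 := fun χ x hx =>
    image_eq_zero_of_notMem_tsupport fun hx' => hx (χ.tsupport_subset hx')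
  refine TestFunction.ext fun x => ?_
  by_cases hx : x ∈ Ioi (0 : ℝ)
  · exact h4 hx
  · rw [h5 φ x hx, h5 ψ x hx]

/-- The operator `𝒜₀` on `L²_ρ(0,∞)` with domain (the image of) `C_0^∞(0,∞)`. -/
noncomputable def opA (f : ℝ → ℝ) (hf : IsSelfSimilarProfile f) :
    WeightedL2 →ₗ.[ℂ] WeightedL2 where
  domain := LinearMap.range testToL2
  toFun := (formalOpToL2 f hf).comp
    (LinearEquiv.ofInjective testToL2 testToL2_injective).symm.toLinearMap

theorem opA_apply (f : ℝ → ℝ) (hf : IsSelfSimilarProfile f) (φ : 𝓓(halfLine, ℂ)) :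
    opA f hf ⟨testToL2 φ, φ, rfl⟩ = formalOpToL2 f hf φ := by
  change formalOpToL2 f hf ((LinearEquiv.ofInjective testToL2 testToL2_injective).symm
    ((LinearEquiv.ofInjective testToL2 testToL2_injective) φ)) = _
  rw [LinearEquiv.symm_apply_apply]

end HarmonicMapFlow

namespace UnboundedOp

variable {H : Type*} [NormedAddCommGroup H] [InnerProductSpace ℂ H]

/-- A densely defined symmetric operator is essentially self-adjoint if its closure is
self-adjoint. -/
structure IsEssentiallySelfAdjoint [CompleteSpace H] (T : H →ₗ.[ℂ] H) : Prop where
  dense_domain : Dense (T.domain : Set H)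
  symmetric : T.IsFormalAdjoint T
  closable : T.IsClosable
  selfAdjoint_closure : IsSelfAdjoint T.closure

/-- `z` is in the resolvent set if `z - S : D(S) → H` is bijective with a bounded inverse `R`. -/
def resolventSet (S : H →ₗ.[ℂ] H) : Set ℂ :=
  {z | ∃ R : H →L[ℂ] H,
    (∀ x : S.domain, R (z • (x : H) - S x) = x) ∧
    (∀ u : H, ∃ h : R u ∈ S.domain, z • R u - S ⟨R u, h⟩ = u)}

/-- The spectrum of an unbounded operator. -/
def spectrum (S : H →ₗ.[ℂ] H) : Set ℂ := (resolventSet S)ᶜ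

/-- The eigenspace `{x ∈ D(S) : S x = z x}`. -/
def eigenspace (S : H →ₗ.[ℂ] H) (z : ℂ) : Submodule ℂ H :=
  (LinearMap.ker (S.toFun - z • S.domain.subtype)).map S.domain.subtype

/-- `z` is an eigenvalue. -/
def IsEigenvalue (S : H →ₗ.[ℂ] H) (z : ℂ) : Prop := eigenspace S z ≠ ⊥

/-- `z` is a simple eigenvalue, i.e. its eigenspace is one-dimensional. -/
def IsSimpleEigenvalue (S : H →ₗ.[ℂ] H) (z : ℂ) : Prop :=
  Module.finrank ℂ (eigenspace S z) = 1

/-- The spectrum is purely discrete: each of its points is an isolated point of the spectrum and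
an eigenvalue of finite multiplicity. -/
def HasPurelyDiscreteSpectrum (S : H →ₗ.[ℂ] H) : Prop :=
  ∀ z ∈ spectrum S, (∃ ε > 0, spectrum S ∩ Metric.ball z ε = {z}) ∧
    IsEigenvalue S z ∧ FiniteDimensional ℂ (eigenspace S z)

theorem mem_eigenspace_iff (S : H →ₗ.[ℂ] H) (z : ℂ) (x : H) :
    x ∈ eigenspace S z ↔ ∃ h : x ∈ S.domain, S ⟨x, h⟩ = z • x := by
  constructor
  · rintro ⟨⟨y, hy⟩, hy', rfl⟩
    exact ⟨hy, sub_eq_zero.1 hy'⟩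
  · rintro ⟨h, hx⟩
    exact ⟨⟨x, h⟩, sub_eq_zero.2 hx, rfl⟩

end UnboundedOp

/-! Since `f 0 = 0` and `f` is differentiable at 0, the potential 2cos(2f)/y² differs from 2/y² by a
bounded function V. So the operator is L + V, where L = -∂² - (2/y - y/2)∂ + 2/y² is explicitly
solvable: L y^(2k+1) = (k + 1/2) y^(2k+1) - 2k(2k+3) y^(2k-1). Thus L is triangular on odd
polynomials, and by symmetry Gram-Schmidt turns the odd monomials into eigenvectors with eigenvalues
k + 1/2. Cutoffs place the monomials in the domain of the closure (`oddMonomial_mem_closure_graph`),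
and their span is dense because a function orthogonal to all of them has zero sine transform
(`dense_span_oddMonomial`).

Hence (L + c)⁻¹ is a compact diagonal operator. With c the norm of multiplication by V, a Neumann
series gives a compact right inverse R of the closure of L + V + c
(`exists_compact_inverse_of_triangular`, `exists_compact_inverse`). For a symmetric operator, such
an R yields self-adjointness, and the spectral theorem for compact symmetric operators, transported
by μ = (z + c)⁻¹, yields a real, discrete, countable and infinite spectrum.

Simplicity is a Wronskian argument. As L y = y/2, writing an eigenvector as u = y v turns the
equation into a first-order system for v and the flux P = -y²ρ v' (`exists_systemSolution`).
Belonging to the domain of the closure forces |P|² ≤ C y⁵ (`norm_flux_sq_le`). The Wronskian of two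
such solutions is constant. Were it nonzero, 1/y would be integrable near 0, so it vanishes and the
two solutions are proportional. -/

namespace UnboundedOp

/-! ### Symmetric operators with a compact right inverse of a real shift. -/

section Abstract

variable {H : Type*} [NormedAddCommGroup H] [InnerProductSpace ℂ H]

theorem symmetric_of_mem_closure {G : Set (H × H)}
    (hG : ∀ p ∈ G, ∀ q ∈ G, ⟪p.2, q.1⟫_ℂ = ⟪p.1, q.2⟫_ℂ) {p q : H × H}
    (hp : p ∈ closure G) (hq : q ∈ closure G) : ⟪p.2, q.1⟫_ℂ = ⟪p.1, q.2⟫_ℂ := by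
  have h := map_mem_closure₂ (f := fun p q : H × H => ⟪p.2, q.1⟫_ℂ - ⟪p.1, q.2⟫_ℂ)
    (u := {0}) (by fun_prop) hp hq (fun a ha b hb => by simp [hG a ha b hb])
  rw [closure_singleton] at h
  exact sub_eq_zero.1 h

theorem graph_symmetric {T : H →ₗ.[ℂ] H} (hT : T.IsFormalAdjoint T) :
    ∀ p ∈ (T.graph : Set (H × H)), ∀ q ∈ (T.graph : Set (H × H)),
      ⟪p.2, q.1⟫_ℂ = ⟪p.1, q.2⟫_ℂ := by
  rintro p hp q hq
  obtain ⟨x, hx1, hx2⟩ := (LinearPMap.mem_graph_iff T).1 hp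
  obtain ⟨y, hy1, hy2⟩ := (LinearPMap.mem_graph_iff T).1 hq
  rw [← hx1, ← hx2, ← hy1, ← hy2]
  exact hT x y

theorem isFormalAdjoint_of_graph {S : H →ₗ.[ℂ] H}
    (h : ∀ p ∈ (S.graph : Set (H × H)), ∀ q ∈ (S.graph : Set (H × H)),
      ⟪p.2, q.1⟫_ℂ = ⟪p.1, q.2⟫_ℂ) : S.IsFormalAdjoint S :=
  fun x y => h (x, S x) (S.mem_graph x) (y, S y) (S.mem_graph y)

theorem isClosable_of_symmetric [CompleteSpace H] {T : H →ₗ.[ℂ] H}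
    (hd : Dense (T.domain : Set H)) (hT : T.IsFormalAdjoint T) : T.IsClosable :=
  (LinearPMap.adjoint_isClosed hd).isClosable.leIsClosable (hT.le_adjoint hd)

theorem closure_isFormalAdjoint [CompleteSpace H] {T : H →ₗ.[ℂ] H}
    (hd : Dense (T.domain : Set H)) (hT : T.IsFormalAdjoint T) :
    T.closure.IsFormalAdjoint T.closure := by
  have hc := isClosable_of_symmetric hd hT
  refine isFormalAdjoint_of_graph fun p hp q hq => ?_
  rw [← hc.graph_closure_eq_closure_graph, Submodule.topologicalClosure_coe] at hp hq
  exact symmetric_of_mem_closure (graph_symmetric hT) hp hq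

/-- `R` is a right inverse of `S + c`. -/
def IsRightInverse (S : H →ₗ.[ℂ] H) (c : ℝ) (R : H →L[ℂ] H) : Prop :=
  ∀ u : H, ∃ h : R u ∈ S.domain, S ⟨R u, h⟩ = u - (c : ℂ) • R u

variable {S : H →ₗ.[ℂ] H} {c : ℝ} {R : H →L[ℂ] H}

/-- This lets the inverse be built inside the closure of the graph, so that the domain of
`T.closure` never has to be described. -/
theorem isRightInverse_closure {T : H →ₗ.[ℂ] H} (hT : T.IsClosable)
    (h : ∀ u, (R u, u - (c : ℂ) • R u) ∈ closure (T.graph : Set (H × H))) :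
    IsRightInverse T.closure c R := by
  intro u
  have h1 := h u
  rw [← Submodule.topologicalClosure_coe, hT.graph_closure_eq_closure_graph] at h1
  obtain ⟨y, hy1, hy2⟩ := (LinearPMap.mem_graph_iff _).1 h1
  simp only at hy1 hy2
  have hm : R u ∈ T.closure.domain := hy1 ▸ y.2
  refine ⟨hm, ?_⟩
  rw [← hy2]
  congr 1
  exact Subtype.ext hy1.symm

theorem IsRightInverse.inner_add (hR : IsRightInverse S c R) (hS : S.IsFormalAdjoint S)
    (x : S.domain) (u : H) : ⟪S x + (c : ℂ) • (x : H), R u⟫_ℂ = ⟪(x : H), u⟫_ℂ := by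
  obtain ⟨h, hu⟩ := hR u
  have := hS x ⟨R u, h⟩
  rw [hu] at this
  rw [inner_add_left, this, inner_sub_right, inner_smul_left, inner_smul_right]
  simp

theorem IsRightInverse.symmetric (hR : IsRightInverse S c R) (hS : S.IsFormalAdjoint S) :
    (R : H →ₗ[ℂ] H).IsSymmetric := by
  intro u v
  obtain ⟨h, hu⟩ := hR u
  have := hR.inner_add hS ⟨R u, h⟩ v
  rw [hu] at this
  simpa using this.symm

/-- The right inverse of `S + c` is also a left inverse. -/
theorem IsRightInverse.left_inverse (hR : IsRightInverse S c R) (hS : S.IsFormalAdjoint S)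
    (x : S.domain) : R (S x + (c : ℂ) • (x : H)) = x := by
  refine ext_inner_right ℂ fun v => ?_
  rw [show ⟪R (S x + (c : ℂ) • (x : H)), v⟫_ℂ = ⟪S x + (c : ℂ) • (x : H), R v⟫_ℂ from
    hR.symmetric hS _ v, hR.inner_add hS]

theorem IsRightInverse.injective (hR : IsRightInverse S c R) {u : H} (hu : R u = 0) : u = 0 := by
  obtain ⟨h, h2⟩ := hR u
  have : (⟨R u, h⟩ : S.domain) = 0 := Subtype.ext hu
  rw [this, S.map_zero, hu] at h2
  simpa using h2.symm

/-- If y lies in the domain of S* and w = (S* + c)y, then ⟪y, v⟫ = ⟪y, (S + c)Rv⟫ = ⟪w, Rv⟫ = ⟪Rw,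
v⟫ for every v. So y = Rw already lies in the domain of S. -/
theorem IsRightInverse.isSelfAdjoint [CompleteSpace H] (hR : IsRightInverse S c R)
    (hS : S.IsFormalAdjoint S) (hd : Dense (S.domain : Set H)) : IsSelfAdjoint S := by
  rw [LinearPMap.isSelfAdjoint_def]
  refine (LinearPMap.eq_of_le_of_domain_eq (hS.le_adjoint hd) ?_).symm
  refine le_antisymm (hS.le_adjoint hd).1 fun y hy => ?_
  set w : H := S.adjoint ⟨y, hy⟩ + (c : ℂ) • y
  have key : y = R w := by
    refine ext_inner_right ℂ fun v => ?_
    obtain ⟨h, hv⟩ := hR v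
    have h1 := LinearPMap.adjoint_isFormalAdjoint hd ⟨y, hy⟩ ⟨R v, h⟩
    rw [hv] at h1
    have h2 : ⟪R w, v⟫_ℂ = ⟪w, R v⟫_ℂ := hR.symmetric hS w v
    rw [h2, inner_add_left, h1, inner_sub_right, inner_smul_left, inner_smul_right]
    simp
  rw [key]
  exact (hR w).1

theorem IsRightInverse.mem_eigenspace_iff (hR : IsRightInverse S c R) (hS : S.IsFormalAdjoint S)
    {z : ℂ} (hz : z + c ≠ 0) (x : H) :
    x ∈ eigenspace S z ↔ x ∈ Module.End.eigenspace (R : H →ₗ[ℂ] H) (z + c)⁻¹ := by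
  rw [UnboundedOp.mem_eigenspace_iff, Module.End.mem_eigenspace_iff]
  constructor
  · rintro ⟨h, hx⟩
    have h1 := hR.left_inverse hS ⟨x, h⟩
    rw [hx, ← add_smul, map_smul] at h1
    change R x = (z + c)⁻¹ • x
    have h2 : (z + c) • R x = x := h1
    conv_rhs => rw [← h2]
    rw [smul_smul, inv_mul_cancel₀ hz, one_smul]

  · intro hx
    have hx' : x = (z + c) • R x := by
      change R x = _ at hx
      rw [hx, smul_smul, mul_inv_cancel₀ hz, one_smul]
    have hmem : R x ∈ S.domain := (hR x).1
    have hmem' : x ∈ S.domain := by rw [hx']; exact S.domain.smul_mem _ hmem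
    refine ⟨hmem', ?_⟩
    have e : (⟨x, hmem'⟩ : S.domain) = (z + c) • ⟨R x, hmem⟩ := Subtype.ext hx'
    rw [e, S.map_smul, (hR x).2, smul_sub]
    nth_rewrite 3 [hx']
    rw [smul_comm _ (c : ℂ), ← hx', ← sub_smul]
    simp

theorem IsRightInverse.eigenspace_eq (hR : IsRightInverse S c R) (hS : S.IsFormalAdjoint S)
    {z : ℂ} (hz : z + c ≠ 0) :
    eigenspace S z = Module.End.eigenspace (R : H →ₗ[ℂ] H) (z + c)⁻¹ :=
  Submodule.ext (hR.mem_eigenspace_iff hS hz)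

theorem IsRightInverse.neg_notMem_spectrum (hR : IsRightInverse S c R)
    (hS : S.IsFormalAdjoint S) : -(c : ℂ) ∉ spectrum S := by
  rw [spectrum, mem_compl_iff, not_not]
  refine ⟨-R, fun x => ?_, fun u => ?_⟩
  · have h : -(c : ℂ) • (x : H) - S x = -(S x + (c : ℂ) • (x : H)) := by
      rw [neg_smul]; abel
    rw [h, map_neg, neg_apply, neg_neg, hR.left_inverse hS x]
  · obtain ⟨h, hu⟩ := hR u
    have h' : (-R) u ∈ S.domain := by simpa using h
    refine ⟨h', ?_⟩
    have e : (⟨(-R) u, h'⟩ : S.domain) = -⟨R u, h⟩ := Subtype.ext (by simp)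
    rw [e, S.map_neg, hu]
    simp

/-- The spectrum of `S` corresponds to the nonzero eigenvalues of the compact operator `R`. -/
theorem IsRightInverse.mem_spectrum_iff [CompleteSpace H] (hR : IsRightInverse S c R)
    (hS : S.IsFormalAdjoint S) (hK : IsCompactOperator R) (z : ℂ) :
    z ∈ spectrum S ↔ z + c ≠ 0 ∧ Module.End.HasEigenvalue (R : H →ₗ[ℂ] H) (z + c)⁻¹ := by
  constructor
  · intro hz
    have hz0 : z + c ≠ 0 := by
      intro h
      rw [eq_neg_of_add_eq_zero_left h] at hz
      exact hR.neg_notMem_spectrum hS hz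
    refine ⟨hz0, ?_⟩
    by_contra hne
    -- Fredholm alternative: a nonzero number that is not an eigenvalue of the compact R makes U =
    -- (z + c)⁻¹ - R invertible.
    have h1 : (z + c)⁻¹ ∉ _root_.spectrum ℂ R := fun h =>
      hne ((hK.hasEigenvalue_iff_mem_spectrum (inv_ne_zero hz0)).2 h)
    rw [_root_.spectrum.notMem_iff] at h1
    obtain ⟨U, hU⟩ := h1
    set Q : H →L[ℂ] H := ((U⁻¹ : (H →L[ℂ] H)ˣ) : H →L[ℂ] H) with hQ
    have hU' : ∀ x, (U : H →L[ℂ] H) x = (z + c)⁻¹ • x - R x := fun x => by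
      rw [hU]; simp [Algebra.algebraMap_eq_smul_one]
    have hUQ : ∀ x, (U : H →L[ℂ] H) (Q x) = x := fun x => by
      rw [← mul_apply_eq_comp, hQ, Units.mul_inv]; simp
    have hQU : ∀ x, Q ((U : H →L[ℂ] H) x) = x := fun x => by
      rw [← mul_apply_eq_comp, hQ, Units.inv_mul]; simp
    have hcomm : ∀ x, R (Q x) = Q (R x) := fun x => by
      have h2 : R ((U : H →L[ℂ] H) (Q x)) = (U : H →L[ℂ] H) (R (Q x)) := by
        rw [hU', hU', map_sub, map_smul]
      rw [hUQ] at h2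
      rw [h2, hQU]
    -- On the domain, R(z - S) = -(z + c)U. Solving for the inverse of z - S with Q = U⁻¹, which
    -- commutes with R, gives this resolvent.
    refine hz ⟨-((z + c)⁻¹ • (R ∘L Q)), fun x => ?_, fun u => ?_⟩
    · have h2 : z • (x : H) - S x = (z + c) • (x : H) - (S x + (c : ℂ) • (x : H)) := by
        rw [add_smul]; abel
      have h3 : R (z • (x : H) - S x) = -((z + c) • (U : H →L[ℂ] H) x) := by
        rw [h2, map_sub, map_smul, hR.left_inverse hS, hU', smul_sub, smul_smul,
          mul_inv_cancel₀ hz0, one_smul]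
        abel
      simp only [neg_apply, smul_apply,
        ContinuousLinearMap.comp_apply]
      rw [hcomm, h3, map_neg, map_smul, hQU, smul_neg, neg_neg, smul_smul, inv_mul_cancel₀ hz0,
        one_smul]
    · obtain ⟨h, hu⟩ := hR (Q u)
      have h' : (-((z + c)⁻¹ • (R ∘L Q))) u ∈ S.domain := by
        simpa using S.domain.smul_mem ((z + c)⁻¹) h
      refine ⟨h', ?_⟩
      have e : (⟨(-((z + c)⁻¹ • (R ∘L Q))) u, h'⟩ : S.domain) = (-(z + c)⁻¹) • ⟨R (Q u), h⟩ :=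
        Subtype.ext (by simp)
      rw [e, S.map_smul, hu]
      have h4 := hUQ u
      rw [hU'] at h4
      have h5 : (-((z + c)⁻¹ • (R ∘L Q))) u = -((z + c)⁻¹ • R (Q u)) := rfl
      rw [h5]
      conv_rhs => rw [← h4]
      rw [neg_smul, smul_sub]
      have h6 : R (Q u) = (z + c)⁻¹ • (z • R (Q u)) + (z + c)⁻¹ • ((c : ℂ) • R (Q u)) := by
        rw [← smul_add, ← add_smul, smul_smul, inv_mul_cancel₀ hz0, one_smul]
      conv_rhs => rw [h6]
      rw [smul_neg, smul_comm z]
      abel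
  · rintro ⟨hz0, he⟩ ⟨Q, hQ, -⟩
    obtain ⟨x, hx, hx0⟩ := he.exists_hasEigenvector
    obtain ⟨h, hSx⟩ := (UnboundedOp.mem_eigenspace_iff S z x).1
      ((hR.mem_eigenspace_iff hS hz0 x).2 hx)
    have := hQ ⟨x, h⟩
    rw [hSx] at this
    simp at this
    exact hx0 this.symm

/-- Unit eigenvectors for distinct eigenvalues are orthogonal, so their images under R are at
distance at least ε from each other. Infinitely many of them would contradict compactness. -/
theorem finite_eigenvalues_norm_ge (hK : IsCompactOperator R)
    (hs : (R : H →ₗ[ℂ] H).IsSymmetric) {ε : ℝ} (hε : 0 < ε) :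
    {μ : ℂ | Module.End.HasEigenvalue (R : H →ₗ[ℂ] H) μ ∧ ε ≤ ‖μ‖}.Finite := by
  by_contra hinf
  set s := {μ : ℂ | Module.End.HasEigenvalue (R : H →ₗ[ℂ] H) μ ∧ ε ≤ ‖μ‖}
  let m : ℕ ↪ s := Set.Infinite.natEmbedding s hinf
  have hex : ∀ n, ∃ x : H, R x = (m n : ℂ) • x ∧ ‖x‖ = 1 := fun n => by
    obtain ⟨x, hx, hx0⟩ := (m n).2.1.exists_hasEigenvector
    rw [Module.End.mem_eigenspace_iff] at hx
    refine ⟨((‖x‖⁻¹ : ℝ) : ℂ) • x, ?_, ?_⟩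
    · rw [map_smul, show R x = _ from hx, smul_comm]
    · rw [norm_smul]
      simp [hx0]
  choose e he hnorm using hex
  have horth : ∀ n k, n ≠ k → ⟪R (e n), R (e k)⟫_ℂ = 0 := fun n k hnk => by
    have h1 := hs.orthogonalFamily_eigenspaces (i := (m n : ℂ)) (j := m k)
      (fun h => hnk (m.injective (Subtype.ext h)))
      ⟨e n, Module.End.mem_eigenspace_iff.2 (he n)⟩ ⟨e k, Module.End.mem_eigenspace_iff.2 (he k)⟩
    replace h1 : ⟪e n, e k⟫_ℂ = 0 := h1
    rw [he, he, inner_smul_left, inner_smul_right, h1]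
    simp
  have hdist : ∀ n k, n ≠ k → ε ≤ dist (R (e n)) (R (e k)) := fun n k hnk => by
    rw [dist_eq_norm]
    have h1 : ‖R (e n) - R (e k)‖ * ‖R (e n) - R (e k)‖ =
        ‖R (e n)‖ * ‖R (e n)‖ + ‖R (e k)‖ * ‖R (e k)‖ := by
      have := norm_add_sq_eq_norm_sq_add_norm_sq_of_inner_eq_zero (𝕜 := ℂ) (R (e n)) (-R (e k))
        (by rw [inner_neg_right, horth n k hnk, neg_zero])
      simpa [sub_eq_add_neg] using this
    have h2 : ε ≤ ‖R (e n)‖ := by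
      rw [he, norm_smul, hnorm, mul_one]; exact (m n).2.2
    by_contra! hlt
    nlinarith [norm_nonneg (R (e n) - R (e k)), mul_self_nonneg ‖R (e k)‖]
  obtain ⟨K, hKc, hKs⟩ := hK.image_closedBall_subset_compact (f := (R : H →ₗ[ℂ] H)) 1
  obtain ⟨a, -, φ, hφ, hlim⟩ := hKc.tendsto_subseq (x := fun n => R (e n))
    (fun n => hKs ⟨e n, by simp [hnorm], rfl⟩)
  obtain ⟨N, hN⟩ := Metric.cauchySeq_iff'.1 hlim.cauchySeq ε hε
  exact absurd (hN (N + 1) (by simp))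
    (not_lt.2 (hdist _ _ (hφ.injective.ne (by simp))))

variable [CompleteSpace H]

theorem IsRightInverse.hasPurelyDiscreteSpectrum (hR : IsRightInverse S c R)
    (hS : S.IsFormalAdjoint S) (hK : IsCompactOperator R) : HasPurelyDiscreteSpectrum S := by
  intro z hz
  obtain ⟨hz0, he⟩ := (hR.mem_spectrum_iff hS hK z).1 hz
  refine ⟨?_, ?_, ?_⟩
  · have hpos : 0 < ‖z + c‖ := norm_pos_iff.2 hz0
    have hfin := finite_eigenvalues_norm_ge hK (hR.symmetric hS) (ε := (2 * ‖z + c‖)⁻¹)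
      (by positivity)
    -- On this ball ‖w + c‖ ≤ 2‖z + c‖, so the eigenvalues (w + c)⁻¹ of R stay away from 0, and only
    -- finitely many do.
    have hfin2 : (spectrum S ∩ Metric.ball z ‖z + c‖).Finite := by
      refine Finite.of_finite_image (f := fun w => (w + c)⁻¹) (hfin.subset ?_) ?_
      · rintro _ ⟨w, ⟨hw, hwz⟩, rfl⟩
        obtain ⟨hw0, hwe⟩ := (hR.mem_spectrum_iff hS hK w).1 hw
        refine ⟨hwe, ?_⟩
        rw [norm_inv]
        refine inv_anti₀ (norm_pos_iff.2 hw0) ?_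
        rw [Metric.mem_ball, dist_eq_norm] at hwz
        calc ‖w + c‖ = ‖(w - z) + (z + c)‖ := by congr 1; ring
          _ ≤ ‖w - z‖ + ‖z + c‖ := norm_add_le _ _
          _ ≤ _ := by linarith
      · intro w _ w' _ h
        simpa using h
    obtain ⟨ε, hε, hb⟩ := Metric.isOpen_iff.1 (hfin2.subset sdiff_subset :
      ((spectrum S ∩ Metric.ball z ‖z + c‖) \ {z}).Finite).isClosed.isOpen_compl z (by simp)
    refine ⟨min ε ‖z + c‖, lt_min hε hpos, ?_⟩
    ext w
    constructor
    · rintro ⟨hw, hwz⟩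
      by_contra hne
      refine hb (Metric.ball_subset_ball (min_le_left _ _) hwz)
        ⟨⟨hw, Metric.ball_subset_ball (min_le_right _ _) hwz⟩, hne⟩
    · rintro rfl
      exact ⟨hz, Metric.mem_ball_self (lt_min hε hpos)⟩
  · rw [IsEigenvalue, hR.eigenspace_eq hS hz0]
    exact he
  · rw [hR.eigenspace_eq hS hz0]
    exact ContinuousLinearMap.finite_dimensional_eigenspace hK _ (inv_ne_zero hz0)

theorem IsRightInverse.spectrum_countable (hR : IsRightInverse S c R)
    (hS : S.IsFormalAdjoint S) (hK : IsCompactOperator R) : (spectrum S).Countable := by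
  have h1 : (⋃ n : ℕ, {μ : ℂ | Module.End.HasEigenvalue (R : H →ₗ[ℂ] H) μ ∧
      (1 / ((n : ℝ) + 1)) ≤ ‖μ‖}).Countable :=
    countable_iUnion fun n =>
      (finite_eigenvalues_norm_ge hK (hR.symmetric hS) (by positivity)).countable
  refine countable_of_injective_of_countable_image (f := fun w => (w + c)⁻¹) ?_ (h1.mono ?_)
  · intro w _ w' _ h
    simpa using h
  · rintro _ ⟨w, hw, rfl⟩
    obtain ⟨hw0, hwe⟩ := (hR.mem_spectrum_iff hS hK w).1 hw
    obtain ⟨n, hn⟩ := exists_nat_one_div_lt (norm_pos_iff.2 (inv_ne_zero hw0))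
    exact mem_iUnion.2 ⟨n, hwe, hn.le⟩

/-- The eigenspaces of R have trivial orthogonal complement, and 0 is not an eigenvalue since R is
injective. A finite spectrum would make H a finite sum of finite-dimensional eigenspaces. -/
theorem IsRightInverse.spectrum_infinite (hR : IsRightInverse S c R)
    (hS : S.IsFormalAdjoint S) (hK : IsCompactOperator R) (hH : ¬ FiniteDimensional ℂ H) :
    (spectrum S).Infinite := by
  intro hfin
  apply hH
  have horth := ContinuousLinearMap.orthogonalComplement_iSup_eigenspaces_eq_bot hK
    (hR.symmetric hS)
  have hle : (⨆ μ, Module.End.eigenspace (R : H →ₗ[ℂ] H) μ) ≤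
      ⨆ z ∈ spectrum S, eigenspace S z := by
    refine iSup_le fun μ => ?_
    by_cases hμ : Module.End.HasEigenvalue (R : H →ₗ[ℂ] H) μ
    · have hμ0 : μ ≠ 0 := by
        rintro rfl
        obtain ⟨x, hx, hx0⟩ := hμ.exists_hasEigenvector
        rw [Module.End.mem_eigenspace_iff, zero_smul] at hx
        exact hx0 (hR.injective hx)
      have e : (μ⁻¹ - c + c : ℂ)⁻¹ = μ := by simp
      have e0 : (μ⁻¹ - c + c : ℂ) ≠ 0 := by simpa using hμ0
      have hmem : μ⁻¹ - c ∈ spectrum S :=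
        (hR.mem_spectrum_iff hS hK _).2 ⟨e0, by rwa [e]⟩
      calc Module.End.eigenspace (R : H →ₗ[ℂ] H) μ = eigenspace S (μ⁻¹ - c) := by
            rw [hR.eigenspace_eq hS e0, e]
        _ ≤ _ := le_iSup₂_of_le (μ⁻¹ - c) hmem le_rfl
    · rw [Module.End.hasEigenvalue_iff, not_not] at hμ
      rw [hμ]; exact bot_le
  have hfd : FiniteDimensional ℂ (⨆ z ∈ spectrum S, eigenspace S z : Submodule ℂ H) := by
    rw [iSup_subtype']
    have := hfin.to_subtype
    have := fun z : spectrum S => (hR.hasPurelyDiscreteSpectrum hS hK z z.2).2.2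
    exact Submodule.finiteDimensional_iSup _
  have hbot : (⨆ z ∈ spectrum S, eigenspace S z : Submodule ℂ H)ᗮ = ⊥ :=
    le_bot_iff.1 (horth ▸ Submodule.orthogonal_le hle)
  rw [Submodule.orthogonal_eq_bot_iff] at hbot
  rw [hbot] at hfd
  exact Module.Finite.equiv (Submodule.topEquiv (R := ℂ) (M := H))

theorem IsRightInverse.im_eq_zero (hR : IsRightInverse S c R)
    (hS : S.IsFormalAdjoint S) (hK : IsCompactOperator R) {z : ℂ} (hz : z ∈ spectrum S) :
    z.im = 0 := by
  obtain ⟨hz0, he⟩ := (hR.mem_spectrum_iff hS hK z).1 hz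
  have h := (hR.symmetric hS).conj_eigenvalue_eq_self he
  rw [map_inv₀, inv_inj, Complex.conj_eq_iff_im] at h
  simpa using h

end Abstract

/-! ### Triangular symmetric relations and their compact inverses. -/

section Diagonal

variable {H : Type*} [NormedAddCommGroup H] [InnerProductSpace ℂ H]

/-- If a symmetric relation is triangular with respect to `p`, with real diagonal `a`, then the
Gram-Schmidt orthogonalization of `p` consists of eigenvectors. -/
theorem gramSchmidt_mem_of_triangular {G : Submodule ℂ (H × H)}
    (hG : ∀ x ∈ G, ∀ y ∈ G, ⟪x.2, y.1⟫_ℂ = ⟪x.1, y.2⟫_ℂ) {p : ℕ → H} {a : ℕ → ℝ}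
    (h : ∀ n, ∃ q ∈ Submodule.span ℂ (p '' Iio n), (p n, (a n : ℂ) • p n + q) ∈ G) (n : ℕ) :
    (InnerProductSpace.gramSchmidt ℂ p n, (a n : ℂ) • InnerProductSpace.gramSchmidt ℂ p n) ∈ G := by
  set P : ℕ → Submodule ℂ H := fun n => Submodule.span ℂ (p '' Iio n) with hP
  have hmono : ∀ {m n}, m ≤ n → P m ≤ P n := fun hmn =>
    Submodule.span_mono (image_mono (Iio_subset_Iio hmn))
  -- Triangularity: the relation carries each `P n` into itself.
  have hinv : ∀ n, ∀ x ∈ P n, ∃ y ∈ P n, (x, y) ∈ G := by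
    intro n x hx
    induction hx using Submodule.span_induction with
    | mem x hx =>
      obtain ⟨m, hm, rfl⟩ := hx
      obtain ⟨q, hq, hqG⟩ := h m
      exact ⟨_, (P n).add_mem ((P n).smul_mem _ (Submodule.subset_span ⟨m, hm, rfl⟩))
        (hmono (le_of_lt hm) hq), hqG⟩
    | zero => exact ⟨0, zero_mem _, zero_mem _⟩
    | add x y _ _ hx hy =>
      obtain ⟨x', hx', hx⟩ := hx
      obtain ⟨y', hy', hy⟩ := hy
      exact ⟨x' + y', add_mem hx' hy', G.add_mem hx hy⟩
    | smul c x _ hx =>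
      obtain ⟨x', hx', hx⟩ := hx
      exact ⟨c • x', Submodule.smul_mem _ _ hx', G.smul_mem c hx⟩
  set e := InnerProductSpace.gramSchmidt ℂ p n with he
  have horth : ∀ x ∈ P n, ⟪x, e⟫_ℂ = 0 := by
    intro x hx
    simp only [hP] at hx
    rw [← InnerProductSpace.span_gramSchmidt_Iio] at hx
    induction hx using Submodule.span_induction with
    | mem x hx =>
      obtain ⟨m, hm, rfl⟩ := hx
      exact InnerProductSpace.gramSchmidt_orthogonal ℂ p (ne_of_lt hm)
    | zero => simp
    | add x y _ _ hx hy => rw [inner_add_left, hx, hy, add_zero]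
    | smul c x _ hx => rw [inner_smul_left, hx, mul_zero]
  have hdiff : e - p n ∈ P n := by
    rw [he, InnerProductSpace.gramSchmidt_def, sub_sub_cancel_left]
    refine neg_mem (sum_mem fun i hi => ?_)
    have h1 : InnerProductSpace.gramSchmidt ℂ p i ∈ P n := by
      simp only [hP]
      rw [← InnerProductSpace.span_gramSchmidt_Iio]
      exact Submodule.subset_span ⟨i, by simpa using hi, rfl⟩
    exact (Submodule.span_le.2 (singleton_subset_iff.2 h1))
      (Submodule.starProjection_apply_mem _ _)
  obtain ⟨q, hq, hqG⟩ := h n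
  obtain ⟨y, hy, hyG⟩ := hinv n _ hdiff
  have hsum := G.add_mem hyG hqG
  rw [Prod.mk_add_mk, sub_add_cancel] at hsum
  set g := y + ((a n : ℂ) • p n + q) with hg
  have hgP : g - (a n : ℂ) • e ∈ P n := by
    have : g - (a n : ℂ) • e = y + q - (a n : ℂ) • (e - p n) := by
      rw [hg, smul_sub]; abel
    rw [this]
    exact sub_mem (add_mem hy hq) ((P n).smul_mem _ hdiff)
  -- The vector d = g - a e lies in `P n` and has a partner x' there. As d ⊥ e, symmetry gives ‖d‖²
  -- = ⟪d, g⟫ = ⟪x', e⟫ = 0.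
  have hzero : g - (a n : ℂ) • e = 0 := by
    obtain ⟨x', hx', hxG⟩ := hinv n _ hgP
    rw [← inner_self_eq_zero (𝕜 := ℂ)]
    rw [inner_sub_right (g - (a n : ℂ) • e), inner_smul_right, horth _ hgP, mul_zero, sub_zero]
    have := hG _ hxG _ hsum
    simp only at this
    rw [← this, horth _ hx']
  rwa [← sub_eq_zero.1 hzero]

theorem norm_sq_sum_smul {e : ℕ → H} (he : Orthonormal ℂ e) (s : Finset ℕ) (l : ℕ → ℂ) :
    ‖∑ i ∈ s, l i • e i‖ ^ 2 = ∑ i ∈ s, ‖l i‖ ^ 2 := by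
  have h := he.inner_sum l l s
  rw [inner_self_eq_norm_sq_to_K] at h
  have h2 : ∀ i, (starRingEnd ℂ) (l i) * l i = ((‖l i‖ ^ 2 : ℝ) : ℂ) := fun i => by
    rw [Complex.conj_mul']; simp
  simp_rw [h2] at h
  rw [← Complex.ofReal_inj]
  push_cast
  simpa using h

/-- The diagonal operator with respect to an orthonormal sequence, with entries decreasing
to zero, is compact. -/
theorem exists_compact_diagonal [CompleteSpace H] {e : ℕ → H} (he : Orthonormal ℂ e) {l : ℕ → ℝ}
    (hl : Antitone l) (hl0 : Tendsto l atTop (𝓝 0)) :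
    ∃ R : H →L[ℂ] H, IsCompactOperator R ∧ ‖R‖ ≤ l 0 ∧ ∀ n, R (e n) = (l n : ℂ) • e n := by
  have hpos : ∀ n, 0 ≤ l n := fun n => hl.le_of_tendsto hl0 n
  let F : Finset ℕ → H →L[ℂ] H := fun s => ∑ i ∈ s, (l i : ℂ) • (innerSL ℂ (e i)).smulRight (e i)
  have hF : ∀ s u, F s u = ∑ i ∈ s, ((l i : ℂ) * ⟪e i, u⟫_ℂ) • e i := fun s u => by
    simp [F, mul_smul]
  -- By Bessel's inequality the blocks beyond n have norm at most `l n`. So the finite-rank partial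
  -- sums are Cauchy in operator norm and their limit is compact.
  have hbound : ∀ (s : Finset ℕ) (n : ℕ), (∀ i ∈ s, n ≤ i) → ‖F s‖ ≤ l n := by
    intro s n hs
    refine ContinuousLinearMap.opNorm_le_bound _ (hpos n) fun u => ?_
    refine le_of_sq_le_sq ?_ (mul_nonneg (hpos n) (norm_nonneg u))
    rw [hF, norm_sq_sum_smul he, mul_pow]
    calc ∑ i ∈ s, ‖(l i : ℂ) * ⟪e i, u⟫_ℂ‖ ^ 2 ≤ ∑ i ∈ s, l n ^ 2 * ‖⟪e i, u⟫_ℂ‖ ^ 2 := by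
          refine Finset.sum_le_sum fun i hi => ?_
          rw [norm_mul, mul_pow, Complex.norm_real, Real.norm_of_nonneg (hpos i)]
          gcongr
          · exact hpos i
          · exact hl (hs i hi)
      _ = l n ^ 2 * ∑ i ∈ s, ‖⟪e i, u⟫_ℂ‖ ^ 2 := by rw [Finset.mul_sum]
      _ ≤ _ := by
          gcongr
          exact he.sum_inner_products_le u
  have hcauchy : CauchySeq fun n => F (Finset.range n) := by
    refine cauchySeq_of_le_tendsto_0' l (fun n m hnm => ?_) hl0
    rw [dist_comm, dist_eq_norm]
    have : F (Finset.range m) - F (Finset.range n) = F (Finset.Ico n m) := by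
      simp only [F]
      rw [Finset.sum_Ico_eq_sub _ hnm]
    rw [this]
    exact hbound _ n fun i hi => (Finset.mem_Ico.1 hi).1
  obtain ⟨R, hR⟩ := cauchySeq_tendsto_of_complete hcauchy
  refine ⟨R, isCompactOperator_of_tendsto hR (Eventually.of_forall fun n => ?_), ?_, fun n => ?_⟩
  · change F (Finset.range n) ∈ compactOperator (RingHom.id ℂ) H H
    refine sum_mem fun i _ => Submodule.smul_mem _ _ ?_
    change IsCompactOperator _
    have h1 : IsCompactOperator (innerSL ℂ (e i)) :=
      isCompactOperator_of_locallyCompactSpace_dom (innerSL ℂ (e i))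
    exact h1.clm_comp ((ContinuousLinearMap.id ℂ ℂ).smulRight (e i))
  · exact le_of_tendsto hR.norm (Eventually.of_forall fun n => hbound _ 0 (by simp))
  · have h1 : Tendsto (fun m => F (Finset.range m) (e n)) atTop (𝓝 (R (e n))) :=
      ((ContinuousLinearMap.apply ℂ H (e n)).continuous.tendsto R).comp hR
    refine tendsto_nhds_unique h1 (tendsto_const_nhds.congr' ?_)
    filter_upwards [eventually_gt_atTop n] with m hm
    rw [hF, Finset.sum_eq_single n]
    · rw [orthonormal_iff_ite.1 he]; simp
    · intro i _ hin
      rw [orthonormal_iff_ite.1 he, if_neg hin]; simp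
    · intro h; simp [hm] at h

/-- A symmetric closed relation, triangular with diagonal `n + 1/2` along a total independent
sequence, has a compact inverse after adding a bounded perturbation and a large constant. -/
theorem exists_compact_inverse_of_triangular [CompleteSpace H] {G : Submodule ℂ (H × H)}
    (hGc : IsClosed (G : Set (H × H)))
    (hG : ∀ x ∈ G, ∀ y ∈ G, ⟪x.2, y.1⟫_ℂ = ⟪x.1, y.2⟫_ℂ) {p : ℕ → H}
    (hp : LinearIndependent ℂ p) (hd : Dense (Submodule.span ℂ (range p) : Set H))
    (h : ∀ n : ℕ, ∃ q ∈ Submodule.span ℂ (p '' Iio n),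
      (p n, (((n : ℝ) + 1 / 2 : ℝ) : ℂ) • p n + q) ∈ G) (W : H →L[ℂ] H) :
    ∃ R : H →L[ℂ] H, IsCompactOperator R ∧
      ∀ u, (R u, u - (‖W‖ : ℂ) • R u - W (R u)) ∈ G := by
  set e := InnerProductSpace.gramSchmidtNormed ℂ p with he
  have heo : Orthonormal ℂ e := InnerProductSpace.gramSchmidtNormed_orthonormal hp
  have heG : ∀ n : ℕ, (e n, (((n : ℝ) + 1 / 2 : ℝ) : ℂ) • e n) ∈ G := fun n => by
    have h1 := G.smul_mem ((‖InnerProductSpace.gramSchmidt ℂ p n‖ : ℂ)⁻¹)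
      (gramSchmidt_mem_of_triangular hG h n)
    rw [Prod.smul_mk, smul_comm] at h1
    exact h1
  have hed : Dense (Submodule.span ℂ (range e) : Set H) := by
    rwa [he, InnerProductSpace.span_gramSchmidtNormed_range, InnerProductSpace.span_gramSchmidt]
  set c : ℝ := ‖W‖
  have hc : 0 ≤ c := norm_nonneg W
  obtain ⟨R, hRK, hRn, hRe⟩ := exists_compact_diagonal heo (l := fun n : ℕ => ((n : ℝ) + 1 / 2 + c)⁻¹)
    (fun m n hmn => by
      have : (m : ℝ) ≤ n := Nat.cast_le.2 hmn
      simp only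
      gcongr)
    (tendsto_inv_atTop_zero.comp (tendsto_atTop_add_const_right _ _
      (tendsto_atTop_add_const_right _ _ tendsto_natCast_atTop_atTop)))
  -- `R` inverts the unperturbed relation plus c. As `G` is closed and `R` is bounded, it suffices
  -- to check this on the span of the eigenvectors.
  have hRG : ∀ u, (R u, u - (c : ℂ) • R u) ∈ G := by
    intro u
    have hcl : IsClosed {u : H | (R u, u - (c : ℂ) • R u) ∈ G} :=
      hGc.preimage (by fun_prop : Continuous fun u : H => (R u, u - (c : ℂ) • R u))
    refine (hcl.closure_subset_iff.2 ?_) (hed u)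
    intro x hx
    induction hx using Submodule.span_induction with
    | mem x hx =>
      obtain ⟨n, rfl⟩ := hx
      have hn : (((n : ℝ) + 1 / 2 + c : ℝ) : ℂ) ≠ 0 := by
        rw [Complex.ofReal_ne_zero]; positivity
      have h1 := G.smul_mem (((((n : ℝ) + 1 / 2 + c)⁻¹ : ℝ) : ℂ)) (heG n)
      have h2 : e n - (c : ℂ) • R (e n) = (((((n : ℝ) + 1 / 2 + c)⁻¹ : ℝ) : ℂ)) •
          (((n : ℝ) + 1 / 2 : ℝ) : ℂ) • e n := by
        rw [hRe, smul_smul, smul_smul]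
        nth_rewrite 1 [← one_smul ℂ (e n)]
        rw [← sub_smul]
        congr 1
        rw [Complex.ofReal_inv, eq_comm, ← div_eq_inv_mul, div_eq_iff hn, sub_mul, mul_assoc,
          inv_mul_cancel₀ hn]
        push_cast
        ring
      change (R (e n), e n - (c : ℂ) • R (e n)) ∈ G
      rw [h2, hRe]
      exact h1
    | zero =>
      change (R 0, (0 : H) - (c : ℂ) • R 0) ∈ G
      rw [map_zero, smul_zero, sub_zero]
      exact G.zero_mem
    | add x y _ _ hx hy =>
      have := G.add_mem hx hy
      rw [Prod.mk_add_mk] at this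
      change (R (x + y), x + y - (c : ℂ) • R (x + y)) ∈ G
      rw [map_add, smul_add]
      convert! this using 2
      abel
    | smul a x _ hx =>
      have := G.smul_mem a hx
      rw [Prod.smul_mk] at this
      change (R (a • x), a • x - (c : ℂ) • R (a • x)) ∈ G
      rw [map_smul, smul_comm (c : ℂ), ← smul_sub]
      exact this
  -- The shift c = ‖W‖ is chosen for this: ‖WR‖ ≤ c / (c + 1/2) < 1, so 1 + WR is invertible and R(1
  -- + WR)⁻¹ inverts the perturbed relation plus c.
  have hlt : ‖-(W ∘L R)‖ < 1 := by
    rw [norm_neg]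
    calc ‖W ∘L R‖ ≤ ‖W‖ * ‖R‖ := ContinuousLinearMap.opNorm_comp_le _ _
      _ ≤ c * (((0 : ℕ) : ℝ) + 1 / 2 + c)⁻¹ := by gcongr
      _ < 1 := by
        rw [← div_eq_mul_inv, div_lt_one (by positivity)]
        simp
  set U := Units.oneSub _ hlt with hU
  set Q : H →L[ℂ] H := ((U⁻¹ : (H →L[ℂ] H)ˣ) : H →L[ℂ] H) with hQ
  have hUQ : ∀ x, Q x + W (R (Q x)) = x := fun x => by
    have : (U : H →L[ℂ] H) (Q x) = x := by
      rw [← mul_apply_eq_comp, hQ, Units.mul_inv]; simp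
    rw [hU, Units.val_oneSub] at this
    simpa using this
  refine ⟨R ∘L Q, hRK.comp_clm Q, fun u => ?_⟩
  have h1 := hRG (Q u)
  have h2 : u - (c : ℂ) • (R ∘L Q) u - W ((R ∘L Q) u) = Q u - (c : ℂ) • R (Q u) := by
    nth_rewrite 1 [← hUQ u]
    simp only [ContinuousLinearMap.comp_apply]
    abel
  rw [h2]
  exact h1

end Diagonal

end UnboundedOp

namespace HarmonicMapFlow

/-! ### The weighted measure. -/

section Measure

variable {E : Type*} [NormedAddCommGroup E] [NormedSpace ℝ E]

theorem rho_nonneg (y : ℝ) : 0 ≤ rho y := by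
  unfold rho; positivity

theorem ae_rhoMeasure_iff {P : ℝ → Prop} :
    (∀ᵐ y ∂rhoMeasure, P y) ↔ ∀ᵐ y ∂volume.restrict (Ioi (0 : ℝ)), P y := by
  rw [rhoMeasure, ae_withDensity_iff continuous_rho.measurable.ennreal_ofReal]
  refine eventually_congr ?_
  filter_upwards [ae_restrict_mem measurableSet_Ioi] with y hy
  simp [rho_pos hy]

theorem ae_rhoMeasure_mem : ∀ᵐ y ∂rhoMeasure, y ∈ Ioi (0 : ℝ) :=
  ae_rhoMeasure_iff.2 (ae_restrict_mem measurableSet_Ioi)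

theorem integrable_rhoMeasure_iff {g : ℝ → E} :
    Integrable g rhoMeasure ↔ IntegrableOn (fun y => rho y • g y) (Ioi 0) := by
  rw [rhoMeasure, integrable_withDensity_iff_integrable_smul'
    continuous_rho.measurable.ennreal_ofReal (by simp), IntegrableOn]
  simp_rw [ENNReal.toReal_ofReal (rho_nonneg _)]

theorem integral_rhoMeasure (g : ℝ → E) :
    ∫ y, g y ∂rhoMeasure = ∫ y in Ioi 0, rho y • g y := by
  rw [rhoMeasure, integral_withDensity_eq_integral_toReal_smul
    continuous_rho.measurable.ennreal_ofReal (by simp)]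
  simp_rw [ENNReal.toReal_ofReal (rho_nonneg _)]

omit [NormedSpace ℝ E] in
theorem aestronglyMeasurable_rhoMeasure_of_continuousOn {g : ℝ → E}
    (hg : ContinuousOn g (Ioi 0)) : AEStronglyMeasurable g rhoMeasure :=
  (hg.aestronglyMeasurable measurableSet_Ioi).mono_ac (withDensity_absolutelyContinuous _ _)

end Measure

/-! ### Multiplication operators and the bounded part of the potential. -/

section Multiplication

/-- Multiplication by a bounded measurable real function on `L²_ρ`. -/
theorem exists_mul_clm {m : ℝ → ℝ} (hm : AEStronglyMeasurable m rhoMeasure) {C : ℝ}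
    (hC : ∀ y, |m y| ≤ C) :
    ∃ W : WeightedL2 →L[ℂ] WeightedL2, ∀ u : WeightedL2, W u =ᵐ[rhoMeasure] fun y => m y • u y := by
  have hb : ∀ (u : WeightedL2) y, ‖m y • u y‖ ≤ C * ‖u y‖ := fun u y => by
    rw [norm_smul]
    exact mul_le_mul_of_nonneg_right (hC y) (norm_nonneg _)
  have hmem : ∀ u : WeightedL2, MemLp (fun y => m y • u y) 2 rhoMeasure := fun u =>
    (Lp.memLp u).of_le_mul (hm.smul (Lp.aestronglyMeasurable u)) (Eventually.of_forall (hb u))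
  let L : WeightedL2 →ₗ[ℂ] WeightedL2 :=
    { toFun := fun u => (hmem u).toLp _
      map_add' := fun u v => by
        refine Lp.ext ?_
        filter_upwards [(hmem (u + v)).coeFn_toLp, (hmem u).coeFn_toLp, (hmem v).coeFn_toLp,
          Lp.coeFn_add u v, Lp.coeFn_add ((hmem u).toLp _) ((hmem v).toLp _)]
          with y h1 h2 h3 h4 h5
        rw [h1, h5, Pi.add_apply, h2, h3, h4, Pi.add_apply, smul_add]
      map_smul' := fun c u => by
        refine Lp.ext ?_
        filter_upwards [(hmem (c • u)).coeFn_toLp, (hmem u).coeFn_toLp,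
          Lp.coeFn_smul c u, Lp.coeFn_smul c ((hmem u).toLp _)] with y h1 h2 h3 h4
        rw [RingHom.id_apply, h1, h4, Pi.smul_apply, h2, h3, Pi.smul_apply, smul_comm] }
  refine ⟨L.mkContinuous C fun u => ?_, fun u => (hmem u).coeFn_toLp⟩
  refine Lp.norm_le_mul_norm_of_ae_le_mul ?_
  filter_upwards [(hmem u).coeFn_toLp] with y h1
  change ‖((hmem u).toLp _ : WeightedL2) y‖ ≤ _
  rw [h1]
  exact hb u y

theorem mul_clm_symmetric {m : ℝ → ℝ} {W : WeightedL2 →L[ℂ] WeightedL2}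
    (hW : ∀ u : WeightedL2, W u =ᵐ[rhoMeasure] fun y => m y • u y) (u v : WeightedL2) :
    ⟪W u, v⟫_ℂ = ⟪u, W v⟫_ℂ := by
  rw [L2.inner_def, L2.inner_def]
  refine integral_congr_ae ?_
  filter_upwards [hW u, hW v] with y h1 h2
  rw [h1, h2]
  simp only [RCLike.inner_apply, Complex.real_smul, map_mul, Complex.conj_ofReal]
  ring

end Multiplication

/-- The bounded part `(2 cos(2f) - 2)/y²` of the potential. -/
noncomputable def boundedPotential (f : ℝ → ℝ) : ℝ → ℝ :=
  (Ioi 0).indicator fun y => (2 * Real.cos (2 * f y) - 2) / y ^ 2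

theorem boundedPotential_of_pos (f : ℝ → ℝ) {y : ℝ} (hy : 0 < y) :
    boundedPotential f y = (2 * Real.cos (2 * f y) - 2) / y ^ 2 :=
  indicator_of_mem (mem_Ioi.2 hy) _

theorem potential_eq (f : ℝ → ℝ) {y : ℝ} (hy : 0 < y) :
    2 * Real.cos (2 * f y) / y ^ 2 = 2 / y ^ 2 + boundedPotential f y := by
  rw [boundedPotential_of_pos f hy]; ring

theorem IsSelfSimilarProfile.continuousOn_boundedPotential {f : ℝ → ℝ}
    (hf : IsSelfSimilarProfile f) : ContinuousOn (boundedPotential f) (Ioi 0) := by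
  have hfc : ContinuousOn f (Ioi 0) := hf.smooth.continuousOn.mono Ioi_subset_Ici_self
  refine ContinuousOn.congr (f := fun y => (2 * Real.cos (2 * f y) - 2) / y ^ 2) ?_
    fun y hy => boundedPotential_of_pos f hy
  refine ContinuousOn.div ?_ (by fun_prop) fun y hy => (pow_pos hy 2).ne'
  exact ((Real.continuous_cos.comp_continuousOn (hfc.const_mul 2)).const_mul 2).sub
    continuousOn_const

/-- The numerator has modulus 4 sin²(f y). Near 0 it is at most 4(K y)², because `f 0 = 0` and `f`
is differentiable there; for y ≥ δ the bound 4/δ² is trivial. -/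
theorem IsSelfSimilarProfile.exists_boundedPotential_le {f : ℝ → ℝ}
    (hf : IsSelfSimilarProfile f) : ∃ C, ∀ y, |boundedPotential f y| ≤ C := by
  have hd : DifferentiableWithinAt ℝ f (Ici 0) 0 :=
    (hf.smooth.differentiableOn (by simp)) 0 self_mem_Ici
  obtain ⟨K, hK⟩ := (hd.hasFDerivWithinAt.isBigO_sub).bound
  obtain ⟨δ, hδ, hball⟩ := Metric.mem_nhdsWithin_iff.1 hK
  have hcos : ∀ a : ℝ, |2 * Real.cos (2 * a) - 2| = 4 * Real.sin a ^ 2 := fun a => by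
    rw [Real.cos_two_mul', abs_of_nonpos]
    · nlinarith [Real.sin_sq_add_cos_sq a]
    · nlinarith [Real.sin_sq_add_cos_sq a, sq_nonneg (Real.sin a)]
  refine ⟨max (4 * K ^ 2) (4 / δ ^ 2), fun y => ?_⟩
  by_cases hy : 0 < y
  swap
  · rw [boundedPotential, indicator_of_notMem (by simpa using hy), abs_zero]
    exact le_max_of_le_left (by positivity)
  rw [boundedPotential_of_pos f hy, abs_div, hcos, abs_of_pos (pow_pos hy 2)]
  rcases lt_or_ge y δ with h | h
  · refine le_max_of_le_left ?_
    have h1 : ‖f y - f 0‖ ≤ K * ‖y - 0‖ := hball ⟨by simpa [abs_of_pos hy] using h, hy.le⟩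
    rw [hf.at_zero, sub_zero, sub_zero, Real.norm_eq_abs, Real.norm_eq_abs, abs_of_pos hy] at h1
    rw [div_le_iff₀ (by positivity), mul_assoc, ← mul_pow]
    have h2 : |Real.sin (f y)| ≤ |f y| := Real.abs_sin_le_abs
    have h3 : Real.sin (f y) ^ 2 ≤ (K * y) ^ 2 := by
      rw [← sq_abs (Real.sin _)]
      exact pow_le_pow_left₀ (abs_nonneg _) (h2.trans h1) 2
    linarith
  · refine le_max_of_le_right ?_
    gcongr
    nlinarith [Real.sin_sq_le_one (f y)]

/-! ### Symmetry of the differential operator on test functions. -/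

section Symmetry

theorem formalOp_of_pos (f : ℝ → ℝ) (w : ℝ → ℂ) {y : ℝ} (hy : 0 < y) :
    rho y • formalOp f w y = -deriv (fun x => rho x • deriv w x) y +
      (rho y * (2 * Real.cos (2 * f y) / y ^ 2)) • w y := by
  rw [formalOp, smul_add, smul_neg, smul_smul, smul_smul, mul_one_div_cancel (rho_pos hy).ne',
    one_smul]

theorem testFunction_apply_zero (φ : 𝓓(halfLine, ℂ)) : φ 0 = 0 :=
  image_eq_zero_of_notMem_tsupport fun h => lt_irrefl (0 : ℝ) (φ.tsupport_subset h)

theorem inner_formalOp_symm (f : ℝ → ℝ) (hf : IsSelfSimilarProfile f) (φ ψ : 𝓓(halfLine, ℂ)) :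
    ⟪formalOpToL2 f hf φ, testToL2 ψ⟫_ℂ = ⟪testToL2 φ, formalOpToL2 f hf ψ⟫_ℂ := by
  set a : ℝ → ℂ := fun x => rho x • deriv φ x with ha
  set b : ℝ → ℂ := fun x => rho x • deriv ψ x with hb
  have had : ContDiff ℝ ∞ a := contDiff_rho_deriv φ
  have hbd : ContDiff ℝ ∞ b := contDiff_rho_deriv ψ
  -- Lagrange's identity: the derivative of this bracket is the difference of the two integrands,
  -- the potential terms cancelling because the potential is real.
  set c : ℝ → ℂ := fun x => (starRingEnd ℂ) (φ x) * b x - (starRingEnd ℂ) (a x) * ψ x with hc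
  have hconj : ∀ g : ℝ → ℂ, ContDiff ℝ ∞ g → ContDiff ℝ ∞ fun x => (starRingEnd ℂ) (g x) :=
    fun g hg => Complex.conjCLE.contDiff.comp hg
  have hcd : ContDiff ℝ ∞ c := ((hconj _ φ.contDiff).mul hbd).sub ((hconj _ had).mul ψ.contDiff)
  have hcs : HasCompactSupport c := by
    refine HasCompactSupport.sub ?_ ?_
    · exact (φ.hasCompactSupport.comp_left (g := starRingEnd ℂ) (map_zero _)).mul_right
    · exact ψ.hasCompactSupport.mul_left
  have hint := HasCompactSupport.integral_Ioi_deriv_eq (hcd.of_le (by simp)) hcs 0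
  have hc0 : c 0 = 0 := by simp [hc, testFunction_apply_zero]
  rw [hc0, neg_zero] at hint
  have hderiv : ∀ y ∈ Ioi (0 : ℝ), deriv c y = rho y • ⟪formalOp f φ y, ψ y⟫_ℂ
      - rho y • ⟪φ y, formalOp f ψ y⟫_ℂ := by
    intro y hy
    have hcj : ∀ (g : ℝ → ℂ) (g' : ℂ), HasDerivAt g g' y →
        HasDerivAt (fun x => (starRingEnd ℂ) (g x)) ((starRingEnd ℂ) g') y := fun g g' hg =>
      (Complex.conjCLE.toContinuousLinearMap.hasFDerivAt.comp_hasDerivAt y hg)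
    have h1 : HasDerivAt φ (deriv φ y) y :=
      (φ.contDiff.differentiable (by simp) y).hasDerivAt
    have h2 : HasDerivAt ψ (deriv ψ y) y :=
      (ψ.contDiff.differentiable (by simp) y).hasDerivAt
    have h3 : HasDerivAt a (deriv a y) y := (had.differentiable (by simp) y).hasDerivAt
    have h4 : HasDerivAt b (deriv b y) y := (hbd.differentiable (by simp) y).hasDerivAt
    have h5 := ((hcj _ _ h1).mul h4).sub ((hcj _ _ h3).mul h2)
    have e1 := formalOp_of_pos f φ hy
    have e2 := formalOp_of_pos f ψ hy
    have e3 : rho y • ⟪formalOp f φ y, ψ y⟫_ℂ =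
        (starRingEnd ℂ) (rho y • formalOp f φ y) * ψ y := by
      simp [RCLike.inner_apply, Complex.real_smul]; ring
    have e4 : rho y • ⟪φ y, formalOp f ψ y⟫_ℂ =
        (starRingEnd ℂ) (φ y) * (rho y • formalOp f ψ y) := by
      simp [RCLike.inner_apply, Complex.real_smul]; ring
    rw [e3, e4, e1, e2]
    refine h5.deriv.trans ?_
    simp only [ha, hb, Complex.real_smul, map_add, map_neg, map_mul, Complex.conj_ofReal]
    ring
  rw [setIntegral_congr_fun measurableSet_Ioi hderiv] at hint
  have hL : ∀ {g h : ℝ → ℂ} (hg : MemLp g 2 rhoMeasure) (hh : MemLp h 2 rhoMeasure),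
      IntegrableOn (fun y => rho y • ⟪g y, h y⟫_ℂ) (Ioi 0) ∧
      ⟪hg.toLp g, hh.toLp h⟫_ℂ = ∫ y in Ioi 0, rho y • ⟪g y, h y⟫_ℂ := by
    intro g h hg hh
    have hae : (fun y => ⟪hg.toLp g y, hh.toLp h y⟫_ℂ) =ᵐ[rhoMeasure] fun y => ⟪g y, h y⟫_ℂ := by
      filter_upwards [hg.coeFn_toLp, hh.coeFn_toLp] with y h1 h2
      rw [h1, h2]
    refine ⟨integrable_rhoMeasure_iff.1 ((L2.integrable_inner _ _).congr hae), ?_⟩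
    rw [L2.inner_def, integral_congr_ae hae, integral_rhoMeasure]
  obtain ⟨i1, j1⟩ := hL (memLp_formalOp hf φ) (memLp_test ψ)
  obtain ⟨i2, j2⟩ := hL (memLp_test φ) (memLp_formalOp hf ψ)
  rw [integral_sub i1 i2] at hint
  change ⟪(memLp_formalOp hf φ).toLp _, (memLp_test ψ).toLp _⟫_ℂ =
    ⟪(memLp_test φ).toLp _, (memLp_formalOp hf ψ).toLp _⟫_ℂ
  rw [j1, j2]
  exact sub_eq_zero.1 hint

theorem opA_isFormalAdjoint (f : ℝ → ℝ) (hf : IsSelfSimilarProfile f) :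
    (opA f hf).IsFormalAdjoint (opA f hf) := by
  rintro ⟨_, φ, rfl⟩ ⟨_, ψ, rfl⟩
  rw [opA_apply, opA_apply]
  exact inner_formalOp_symm f hf φ ψ

theorem test_mem_graph (f : ℝ → ℝ) (hf : IsSelfSimilarProfile f) (φ : 𝓓(halfLine, ℂ)) :
    (testToL2 φ, formalOpToL2 f hf φ) ∈ (opA f hf).graph := by
  rw [LinearPMap.mem_graph_iff]
  exact ⟨⟨testToL2 φ, φ, rfl⟩, rfl, opA_apply f hf φ⟩

theorem mem_graph_opA_iff (f : ℝ → ℝ) (hf : IsSelfSimilarProfile f)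
    (p : WeightedL2 × WeightedL2) :
    p ∈ (opA f hf).graph ↔ ∃ φ, (testToL2 φ, formalOpToL2 f hf φ) = p := by
  constructor
  · intro hp
    obtain ⟨⟨_, φ, rfl⟩, h1, h2⟩ := (LinearPMap.mem_graph_iff _).1 hp
    rw [opA_apply] at h2
    exact ⟨φ, Prod.ext h1 h2⟩
  · rintro ⟨φ, rfl⟩
    exact test_mem_graph f hf φ

end Symmetry

/-! ### Cutoffs near 0 and infinity, and dominated convergence in L². -/

section Cutoff

/-- The quantities x η' and x² η'' are unchanged in size by dilations of the argument; this yields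
bounds uniform in n for the rescaled cutoffs. -/
theorem exists_smooth_step : ∃ η : ℝ → ℝ, ∃ C : ℝ, ContDiff ℝ ∞ η ∧ (∀ x ≤ 1, η x = 0) ∧
    (∀ x, 2 ≤ x → η x = 1) ∧ 1 ≤ C ∧ (∀ x, 0 ≤ η x ∧ η x ≤ 1) ∧ (∀ x, |x * deriv η x| ≤ C) ∧
    ∀ x, |x ^ 2 * deriv (deriv η) x| ≤ C := by
  set η : ℝ → ℝ := fun x => Real.smoothTransition (x - 1) with hη
  have hd : ContDiff ℝ ∞ η := Real.smoothTransition.contDiff.comp (contDiff_id.sub contDiff_const)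
  have h0 : ∀ x ≤ 1, η x = 0 := fun x hx =>
    Real.smoothTransition.zero_of_nonpos (by linarith)
  have h1 : ∀ x, 2 ≤ x → η x = 1 := fun x hx =>
    Real.smoothTransition.one_of_one_le (by linarith)
  have hd1 : ContDiff ℝ ∞ (deriv η) := (contDiff_infty_iff_deriv.1 hd).2
  have hd2 : ContDiff ℝ ∞ (deriv (deriv η)) := (contDiff_infty_iff_deriv.1 hd1).2
  have hz : ∀ x ∉ Icc (1 : ℝ) 2, deriv η =ᶠ[𝓝 x] 0 := by
    intro x hx
    have : ∃ c : ℝ, η =ᶠ[𝓝 x] fun _ => c := by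
      rcases lt_or_ge x 1 with h | h
      · exact ⟨0, by filter_upwards [Iio_mem_nhds h] with z hz using h0 z (le_of_lt hz)⟩
      · have h' : 2 < x := by
          by_contra! h'
          exact hx ⟨h, h'⟩
        exact ⟨1, by filter_upwards [Ioi_mem_nhds h'] with z hz using h1 z (le_of_lt hz)⟩
    obtain ⟨c, hc⟩ := this
    filter_upwards [hc.eventuallyEq_nhds] with z hz
    rw [hz.deriv_eq]; simp
  obtain ⟨C1, hC1⟩ := (continuous_id.mul hd1.continuous).bounded_above_of_compact_support
    (HasCompactSupport.intro (isCompact_Icc (a := (1 : ℝ)) (b := 2)) fun x hx => by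
      simp [(hz x hx).eq_of_nhds])
  obtain ⟨C2, hC2⟩ := ((continuous_id.pow 2).mul hd2.continuous).bounded_above_of_compact_support
    (HasCompactSupport.intro (isCompact_Icc (a := (1 : ℝ)) (b := 2)) fun x hx => by
      have h := (hz x hx).deriv_eq
      simp [h])
  refine ⟨η, max 1 (max C1 C2), hd, h0, h1, le_max_left _ _, fun x =>
    ⟨Real.smoothTransition.nonneg _, Real.smoothTransition.le_one _⟩, fun x => ?_, fun x => ?_⟩
  · exact (hC1 x).trans ((le_max_left _ _).trans (le_max_right _ _))
  · exact (hC2 x).trans ((le_max_right _ _).trans (le_max_right _ _))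

/-- Cutoff functions on the half-line with scale-invariant bounds. -/
theorem exists_cutoff : ∃ χ : ℕ → ℝ → ℝ, ∃ C : ℝ, (∀ n, ContDiff ℝ ∞ (χ n)) ∧
    (∀ n, HasCompactSupport (χ n)) ∧ (∀ n, tsupport (χ n) ⊆ Ioi 0) ∧
    (∀ y, 0 < y → ∀ᶠ n in atTop, χ n =ᶠ[𝓝 y] fun _ => 1) ∧
    ∀ n y, |χ n y| ≤ C ∧ |y * deriv (χ n) y| ≤ C ∧ |y ^ 2 * deriv (deriv (χ n)) y| ≤ C := by
  obtain ⟨η, C, hd, h0, h1, hC, hb0, hb1, hb2⟩ := exists_smooth_step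
  have hNpos : ∀ n : ℕ, (0 : ℝ) < n + 1 := fun n => by positivity
  set χ : ℕ → ℝ → ℝ := fun n y => η ((n + 1) * y) * (1 - η (y / (n + 1))) with hχ
  have hzero : ∀ (n : ℕ) (y : ℝ), y ∉ Icc (1 / ((n : ℝ) + 1)) (2 * (n + 1)) → χ n y = 0 := by
    intro n y hy
    have hN := hNpos n
    rcases lt_or_ge y (1 / ((n : ℝ) + 1)) with h | h
    · rw [lt_div_iff₀ hN, mul_comm] at h
      simp [hχ, h0 _ h.le]
    · have h' : 2 * ((n : ℝ) + 1) < y := by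
        by_contra! h'
        exact hy ⟨h, h'⟩
      have : 2 ≤ y / (n + 1) := by rw [le_div_iff₀ hN]; exact h'.le
      simp [hχ, h1 _ this]
  have hts : ∀ n, tsupport (χ n) ⊆ Icc (1 / ((n : ℝ) + 1)) (2 * (n + 1)) := fun n =>
    closure_minimal (fun y hy => by_contra fun h => hy (hzero n y h)) isClosed_Icc
  have hd1 : ContDiff ℝ ∞ (deriv η) := (contDiff_infty_iff_deriv.1 hd).2
  -- The largest bound is that of y² χ'': the product rule gives C + 2C² + C, which is at most 4C²
  -- since C ≥ 1.
  refine ⟨χ, 4 * C ^ 2, fun n => ?_, fun n => ?_, fun n y hy => ?_, fun y hy => ?_,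
    fun n y => ?_⟩
  · exact (hd.comp (contDiff_const.mul contDiff_id)).mul
      (contDiff_const.sub (hd.comp (contDiff_id.div_const _)))
  · exact HasCompactSupport.intro isCompact_Icc (hzero n)
  · exact lt_of_lt_of_le (by have := hNpos n; positivity) (hts n hy).1
  · obtain ⟨n0, hn0⟩ := exists_nat_gt (max (4 / y) (2 * y))
    filter_upwards [eventually_ge_atTop n0] with n hn
    have hnn : max (4 / y) (2 * y) < (n : ℝ) + 1 := by
      have : (n0 : ℝ) ≤ n := Nat.cast_le.2 hn
      linarith
    have ha := (le_max_left _ _).trans_lt hnn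
    have hb := (le_max_right _ _).trans_lt hnn
    filter_upwards [Ioo_mem_nhds (a := y / 2) (b := 2 * y) (by linarith) (by linarith)] with z hz
    have hN := hNpos n
    have e1 : 2 ≤ ((n : ℝ) + 1) * z := by
      rw [div_lt_iff₀ hy] at ha
      nlinarith [hz.1]
    have e2 : z / ((n : ℝ) + 1) ≤ 1 := by
      rw [div_le_one hN]; linarith [hz.2]
    simp [hχ, h1 _ e1, h0 _ e2]
  · have hN := hNpos n
    set N : ℝ := (n : ℝ) + 1 with hNdef
    have hη : ∀ x, HasDerivAt η (deriv η x) x := fun x =>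
      (hd.differentiable (by simp) x).hasDerivAt
    have hη' : ∀ x, HasDerivAt (deriv η) (deriv (deriv η) x) x := fun x =>
      (hd1.differentiable (by simp) x).hasDerivAt
    have l1 : ∀ x : ℝ, HasDerivAt (fun y => N * y) N x := fun x => by
      simpa using (hasDerivAt_id x).const_mul N
    have l2 : ∀ x : ℝ, HasDerivAt (fun y => y / N) (1 / N) x := fun x =>
      (hasDerivAt_id x).div_const N
    have a1 : ∀ x, HasDerivAt (fun y => η (N * y)) (deriv η (N * x) * N) x := fun x =>
      (hη (N * x)).comp x (l1 x)
    have a2 : ∀ x, HasDerivAt (fun y => η (y / N)) (deriv η (x / N) * (1 / N)) x := fun x =>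
      HasDerivAt.comp x (h₂ := η) (h := fun y => y / N) (hη (x / N)) (l2 x)
    have b1 : ∀ x, HasDerivAt (fun y => deriv η (N * y)) (deriv (deriv η) (N * x) * N) x :=
      fun x => (hη' (N * x)).comp x (l1 x)
    have b2 : ∀ x, HasDerivAt (fun y => deriv η (y / N))
        (deriv (deriv η) (x / N) * (1 / N)) x := fun x =>
      HasDerivAt.comp x (h₂ := deriv η) (h := fun y => y / N) (hη' (x / N)) (l2 x)
    have hD : deriv (χ n) = fun x => deriv η (N * x) * N * (1 - η (x / N)) +
        η (N * x) * (-(deriv η (x / N) * (1 / N))) := by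
      funext x
      exact ((a1 x).mul ((a2 x).const_sub 1)).deriv
    have hDD := (((b1 y).mul_const N).mul ((a2 y).const_sub 1)).add
      ((a1 y).mul ((b2 y).mul_const (1 / N)).neg)
    rw [hD]
    have hDD' := hDD.deriv
    set A := N * y * deriv η (N * y) with hA
    set B := y / N * deriv η (y / N) with hB
    set A' := (N * y) ^ 2 * deriv (deriv η) (N * y) with hA'
    set B' := (y / N) ^ 2 * deriv (deriv η) (y / N) with hB'
    have bA : |A| ≤ C := hb1 _
    have bB : |B| ≤ C := hb1 _
    have bA' : |A'| ≤ C := hb2 _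
    have bB' : |B'| ≤ C := hb2 _
    have bu : |η (N * y)| ≤ 1 := abs_le.2 ⟨by linarith [(hb0 (N * y)).1], (hb0 _).2⟩
    have bv : |1 - η (y / N)| ≤ 1 :=
      abs_le.2 ⟨by linarith [(hb0 (y / N)).2], by linarith [(hb0 (y / N)).1]⟩
    have hC2 : C ≤ C ^ 2 := by nlinarith
    refine ⟨?_, ?_, ?_⟩
    · rw [hχ, abs_mul]
      have := mul_le_mul bu bv (abs_nonneg _) zero_le_one
      nlinarith
    · have : y * (deriv η (N * y) * N * (1 - η (y / N)) +
        η (N * y) * (-(deriv η (y / N) * (1 / N)))) = A * (1 - η (y / N)) - η (N * y) * B := by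
        rw [hA, hB]; ring
      rw [this]
      have t1 := mul_le_mul bA bv (abs_nonneg _) (by linarith)
      have t2 := mul_le_mul bu bB (abs_nonneg _) zero_le_one
      rw [← abs_mul] at t1 t2
      have := abs_sub (A * (1 - η (y / N))) (η (N * y) * B)
      nlinarith
    · have e : y ^ 2 * deriv (fun x => deriv η (N * x) * N * (1 - η (x / N)) +
        η (N * x) * (-(deriv η (x / N) * (1 / N)))) y =
          A' * (1 - η (y / N)) - 2 * (A * B) - η (N * y) * B' := by
        refine (congrArg (y ^ 2 * ·) hDD').trans ?_
        simp only [hA, hB, hA', hB', Pi.neg_apply]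
        field_simp
        ring
      rw [e]
      have t1 := mul_le_mul bA' bv (abs_nonneg _) (by linarith)
      have t2 := mul_le_mul bu bB' (abs_nonneg _) zero_le_one
      have t3 := mul_le_mul bA bB (abs_nonneg _) (by linarith)
      rw [← abs_mul] at t1 t2 t3
      have s1 := abs_sub (A' * (1 - η (y / N)) - 2 * (A * B)) (η (N * y) * B')
      have s2 := abs_sub (A' * (1 - η (y / N))) (2 * (A * B))
      rw [abs_mul 2, abs_two] at s2
      nlinarith

end Cutoff

/-- Dominated convergence applied to ‖F n - f‖², with majorant (2D)². -/
theorem tendsto_toLp_of_dominated {α E : Type*} [MeasurableSpace α] {μ : Measure α}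
    [NormedAddCommGroup E] {F : ℕ → α → E} {f : α → E} {D : α → ℝ}
    (hF : ∀ n, MemLp (F n) 2 μ) (hf : MemLp f 2 μ) (hD : MemLp D 2 μ)
    (hb : ∀ n, ∀ᵐ y ∂μ, ‖F n y‖ ≤ D y)
    (hlim : ∀ᵐ y ∂μ, Tendsto (fun n => F n y) atTop (𝓝 (f y))) :
    Tendsto (fun n => (hF n).toLp (F n)) atTop (𝓝 (hf.toLp f)) := by
  rw [Lp.tendsto_Lp_iff_tendsto_eLpNorm'']
  have h2 : ∀ n, eLpNorm (F n - f) 2 μ = (∫⁻ y, ‖F n y - f y‖ₑ ^ (2 : ℝ) ∂μ) ^ (1 / 2 : ℝ) :=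
    fun n => by
      rw [eLpNorm_eq_lintegral_rpow_enorm_toReal (by simp) (by simp)]; simp
  simp_rw [h2]
  have hfD : ∀ᵐ y ∂μ, ‖f y‖ ≤ D y := by
    filter_upwards [hlim, ae_all_iff.2 hb] with y h1 h3
    exact le_of_tendsto h1.norm (Eventually.of_forall h3)
  have key : Tendsto (fun n => ∫⁻ y, ‖F n y - f y‖ₑ ^ (2 : ℝ) ∂μ) atTop (𝓝 (∫⁻ _, 0 ∂μ)) := by
    refine tendsto_lintegral_of_dominated_convergence' (fun y => ‖(2 : ℝ) * D y‖ₑ ^ (2 : ℝ))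
      (fun n => ?_) (fun n => ?_) ?_ ?_
    · exact (((hF n).1.sub hf.1).enorm).pow_const _
    · filter_upwards [hb n, hfD] with y h1 h3
      refine ENNReal.rpow_le_rpow ?_ (by norm_num)
      rw [enorm_le_iff_norm_le]
      calc ‖F n y - f y‖ ≤ ‖F n y‖ + ‖f y‖ := norm_sub_le _ _
        _ ≤ 2 * D y := by linarith
        _ ≤ _ := le_abs_self _
    · have := lintegral_rpow_enorm_lt_top_of_eLpNorm_lt_top (by simp) (by simp)
        (hD.const_mul 2).2
      simpa using this.ne
    · filter_upwards [hlim] with y h1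
      have h3 : Tendsto (fun n => ‖F n y - f y‖ₑ) atTop (𝓝 0) := by
        have := (h1.sub_const (f y)).enorm
        simpa using this
      have h4 := (ENNReal.continuous_rpow_const (y := 2)).tendsto 0
      simpa [Function.comp_def] using h4.comp h3
  rw [lintegral_zero] at key
  have h4 := (ENNReal.continuous_rpow_const (y := 1 / 2)).tendsto 0
  simpa [Function.comp_def] using h4.comp key

/-! ### Odd monomials in the domain of the closure. -/

section Monomials

theorem memLp_rhoMeasure_of_continuousOn {g : ℝ → ℝ} (hg : ContinuousOn g (Ioi 0))
    (hi : IntegrableOn (fun y => rho y * g y ^ 2) (Ioi 0)) : MemLp g 2 rhoMeasure := by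
  rw [memLp_two_iff_integrable_sq (aestronglyMeasurable_rhoMeasure_of_continuousOn hg),
    integrable_rhoMeasure_iff]
  exact hi

theorem integrable_pow_mul_exp {a : ℝ} (ha : 0 < a) (m : ℕ) :
    Integrable fun y : ℝ => y ^ m * Real.exp (-a * y ^ 2) := by
  have := integrable_rpow_mul_exp_neg_mul_sq ha (s := m) (by
    have : (0 : ℝ) ≤ m := Nat.cast_nonneg m
    linarith)
  simpa using this

theorem memLp_pow (m : ℕ) : MemLp (fun y : ℝ => y ^ m) 2 rhoMeasure := by
  refine memLp_rhoMeasure_of_continuousOn (by fun_prop) ?_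
  refine ((integrable_pow_mul_exp (a := 1 / 4) (by norm_num) (2 * m + 2)).integrableOn).congr_fun
    (fun y _ => ?_) measurableSet_Ioi
  simp only [rho]
  rw [show -(y ^ 2 / 4) = -(1 / 4) * y ^ 2 by ring]
  ring

/-- For k = 0 the function is 1/y, whose singularity is cancelled by the factor y² of the weight.
The quotient form avoids truncated subtraction in the exponent. -/
theorem memLp_pow_div_sq (k : ℕ) :
    MemLp (fun y : ℝ => y ^ (2 * k + 1) / y ^ 2) 2 rhoMeasure := by
  refine memLp_rhoMeasure_of_continuousOn (ContinuousOn.div (by fun_prop) (by fun_prop)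
    fun _ hy => (pow_pos hy 2).ne') ?_
  refine ((integrable_pow_mul_exp (a := 1 / 4) (by norm_num) (4 * k)).integrableOn).congr_fun
    (fun y hy => ?_) measurableSet_Ioi
  simp only [rho]
  rw [show -(y ^ 2 / 4) = -(1 / 4) * y ^ 2 by ring]
  have : y ≠ 0 := ne_of_gt hy
  field_simp
  ring

theorem hasDerivAt_rho {y : ℝ} (_ : y ≠ 0) : HasDerivAt rho ((2 / y - y / 2) * rho y) y := by
  have h1 : HasDerivAt (fun y : ℝ => -(y ^ 2 / 4)) (-(y / 2)) y :=
    ((hasDerivAt_pow 2 y).div_const 4).neg.congr_deriv (by push_cast; ring)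
  have h2 := (hasDerivAt_pow 2 y).mul h1.exp
  have h3 : HasDerivAt rho _ y := h2
  refine h3.congr_deriv ?_
  simp only [rho]
  field_simp
  push_cast
  ring

theorem formalOp_ofReal (f : ℝ → ℝ) {w w1 : ℝ → ℝ} {w2 y : ℝ} (hy : 0 < y)
    (hw : ∀ᶠ x in 𝓝 y, HasDerivAt w (w1 x) x) (hw1 : HasDerivAt w1 w2 y) :
    formalOp f (fun x => (w x : ℂ)) y =
      ((-w2 - (2 / y - y / 2) * w1 y + (2 / y ^ 2 + boundedPotential f y) * w y : ℝ) : ℂ) := by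
  have h1 : (fun x => rho x • deriv (fun x => (w x : ℂ)) x) =ᶠ[𝓝 y]
      fun x => ((rho x * w1 x : ℝ) : ℂ) := by
    filter_upwards [hw] with x hx
    rw [hx.ofReal_comp.deriv, Complex.real_smul, Complex.ofReal_mul]
  have h2 := ((hasDerivAt_rho hy.ne').mul hw1).ofReal_comp
  have h3 : deriv (fun x => rho x • deriv (fun x => (w x : ℂ)) x) y =
      (((2 / y - y / 2) * rho y * w1 y + rho y * w2 : ℝ) : ℂ) := by
    rw [h1.deriv_eq]; exact h2.deriv
  rw [formalOp, h3, potential_eq f hy, Complex.real_smul, Complex.real_smul]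
  have := (rho_pos hy).ne'
  norm_cast
  field_simp
  ring

/-- The odd monomial `y ^ (2k+1)` in `L²_ρ`. -/
noncomputable def oddMonomial (k : ℕ) : WeightedL2 :=
  ((memLp_pow (2 * k + 1)).ofReal (K := ℂ)).toLp _

theorem oddMonomial_ae (k : ℕ) :
    oddMonomial k =ᵐ[rhoMeasure] fun y => ((y ^ (2 * k + 1) : ℝ) : ℂ) :=
  MemLp.coeFn_toLp _

/-- Once y^(2k-1) is factored out, χ enters only through χ, y χ' and y² χ'', which are the
quantities bounded uniformly in `exists_cutoff`. -/
theorem formalOp_mul_pow (f : ℝ → ℝ) {χ : ℝ → ℝ} (hχ : ContDiff ℝ ∞ χ) (k : ℕ) {y : ℝ}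
    (hy : 0 < y) :
    formalOp f (fun x => ((χ x * x ^ (2 * k + 1) : ℝ) : ℂ)) y =
      ((y ^ (2 * k + 1) / y ^ 2 * (-(y ^ 2 * deriv (deriv χ) y) -
        2 * (2 * k + 1) * (y * deriv χ y) - (2 * k + 1) * (2 * k) * χ y
        - (2 - y ^ 2 / 2) * (y * deriv χ y + (2 * k + 1) * χ y)
        + (2 + y ^ 2 * boundedPotential f y) * χ y) : ℝ) : ℂ) := by
  have hχ1 : ContDiff ℝ ∞ (deriv χ) := (contDiff_infty_iff_deriv.1 hχ).2
  have h1 : ∀ x, HasDerivAt χ (deriv χ x) x := fun x =>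
    (hχ.differentiable (by simp) x).hasDerivAt
  have h2 : ∀ x, HasDerivAt (deriv χ) (deriv (deriv χ) x) x := fun x =>
    (hχ1.differentiable (by simp) x).hasDerivAt
  have h3 : ∀ x : ℝ, HasDerivAt (fun x : ℝ => x ^ (2 * k + 1)) ((2 * k + 1) * x ^ (2 * k)) x :=
    fun x => by simpa using hasDerivAt_pow (2 * k + 1) x
  have h4 : HasDerivAt (fun x : ℝ => x ^ (2 * k)) (2 * k * y ^ (2 * k) / y) y := by
    refine (hasDerivAt_pow (2 * k) y).congr_deriv ?_
    rcases Nat.eq_zero_or_pos k with rfl | hk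
    · simp
    · rw [← pow_sub_one_mul (n := 2 * k) (by omega) y]
      push_cast
      field_simp
  rw [formalOp_ofReal f (w := fun x => χ x * x ^ (2 * k + 1)) hy (w1 := fun x => deriv χ x * x ^ (2 * k + 1) +
    χ x * ((2 * k + 1) * x ^ (2 * k))) (Eventually.of_forall fun x => (h1 x).mul (h3 x))
    (((h2 y).mul (h3 y)).add ((h1 y).mul (h4.const_mul _)))]
  norm_cast
  rw [pow_succ y (2 * k)]
  push_cast
  field_simp
  ring

/-- The function is the differential expression applied to y^(2k+1): diagonal term, subdiagonal term
and bounded potential. -/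
theorem memLp_formalOp_pow {f : ℝ → ℝ} (hf : IsSelfSimilarProfile f) (k : ℕ) :
    MemLp (fun y : ℝ => ((k : ℝ) + 1 / 2) * y ^ (2 * k + 1) -
      2 * k * (2 * k + 3) * (y ^ (2 * k + 1) / y ^ 2) +
      boundedPotential f y * y ^ (2 * k + 1)) 2 rhoMeasure := by
  refine (((memLp_pow (2 * k + 1)).const_mul _).sub ((memLp_pow_div_sq k).const_mul _)).add ?_
  obtain ⟨C, hC⟩ := hf.exists_boundedPotential_le
  refine (memLp_pow (2 * k + 1)).of_le_mul (c := C)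
    (aestronglyMeasurable_rhoMeasure_of_continuousOn
      (hf.continuousOn_boundedPotential.mul (by fun_prop))) (Eventually.of_forall fun y => ?_)
  rw [norm_mul]
  exact mul_le_mul_of_nonneg_right (hC y) (norm_nonneg _)

/-- The odd monomials belong to the domain of the closure of `𝒜₀`. -/
theorem oddMonomial_mem_closure_graph {f : ℝ → ℝ} (hf : IsSelfSimilarProfile f) (k : ℕ) :
    (oddMonomial k, ((memLp_formalOp_pow hf k).ofReal (K := ℂ)).toLp _) ∈
      closure ((opA f hf).graph : Set (WeightedL2 × WeightedL2)) := by
  obtain ⟨χ, C, hχd, hχc, hχs, hχ1, hχb⟩ := exists_cutoff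
  obtain ⟨Cp, hCp⟩ := hf.exists_boundedPotential_le
  have hC0 : 0 ≤ C := (abs_nonneg _).trans (hχb 0 0).1
  have hCp0 : 0 ≤ Cp := (abs_nonneg _).trans (hCp 0)
  let φ : ℕ → 𝓓(halfLine, ℂ) := fun n =>
    { toFun := fun x => ((χ n x * x ^ (2 * k + 1) : ℝ) : ℂ)
      contDiff' := Complex.ofRealCLM.contDiff.comp ((hχd n).mul (contDiff_id.pow _))
      hasCompactSupport' := HasCompactSupport.comp_left (g := ((↑) : ℝ → ℂ))
        ((hχc n).mul_right (f' := fun x : ℝ => x ^ (2 * k + 1))) Complex.ofReal_zero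
      tsupport_subset' := by
        refine (closure_mono ?_).trans (hχs n)
        intro x hx h0
        exact hx (by simp [h0]) }
  have hφ : ∀ n, (φ n : ℝ → ℂ) = fun x => ((χ n x * x ^ (2 * k + 1) : ℝ) : ℂ) := fun n => rfl
  have hD : ∀ K : ℝ, MemLp (fun y : ℝ => K * (y ^ (2 * k + 1) / y ^ 2 + y ^ (2 * k + 1))) 2
      rhoMeasure := fun K => ((memLp_pow_div_sq k).add (memLp_pow _)).const_mul K
  refine mem_closure_of_tendsto (b := atTop)
    (f := fun n => (testToL2 (φ n), formalOpToL2 f hf (φ n))) ?_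
    (Eventually.of_forall fun n => test_mem_graph f hf (φ n))
  refine Tendsto.prodMk_nhds ?_ ?_
  · refine tendsto_toLp_of_dominated (fun n => memLp_test (φ n)) _
      (D := fun y => C * y ^ (2 * k + 1)) ((memLp_pow _).const_mul C) (fun n => ?_) ?_
    · filter_upwards [ae_rhoMeasure_mem] with y hy
      have hy0 : 0 < y := hy
      rw [hφ, Complex.norm_real, norm_mul, Real.norm_of_nonneg (pow_pos hy0 _).le]
      exact mul_le_mul_of_nonneg_right (hχb n y).1 (pow_pos hy0 _).le
    · filter_upwards [ae_rhoMeasure_mem] with y hy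
      refine tendsto_const_nhds.congr' ?_
      filter_upwards [hχ1 y hy] with n hn
      rw [hφ]
      change _ = ((χ n y * y ^ (2 * k + 1) : ℝ) : ℂ)
      rw [hn.eq_of_nhds, one_mul]
      rfl
  -- K adds up the bounds of the terms in `formalOp_mul_pow`, each being at most a constant times 1
  -- + y². The majorant is then K(y^(2k-1) + y^(2k+1)), which lies in L²_ρ.
  · set K : ℝ := C + 2 * (2 * k + 1) * C + (2 * k + 1) * (2 * k) * C + 2 * (C + (2 * k + 1) * C)
      + (2 + Cp) * C with hK
    refine tendsto_toLp_of_dominated (fun n => memLp_formalOp hf (φ n)) _ (hD K) (fun n => ?_) ?_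
    · filter_upwards [ae_rhoMeasure_mem] with y hy
      have hy0 : 0 < y := hy
      rw [hφ, formalOp_mul_pow f (hχd n) k hy0, Complex.norm_real, norm_mul,
        Real.norm_of_nonneg (by positivity)]
      have e : K * (y ^ (2 * k + 1) / y ^ 2 + y ^ (2 * k + 1)) =
          y ^ (2 * k + 1) / y ^ 2 * (K * (1 + y ^ 2)) := by
        field_simp
      rw [e]
      refine mul_le_mul_of_nonneg_left ?_ (by positivity)
      obtain ⟨b0, b1, b2⟩ := hχb n y
      have b3 := hCp y
      set A := y ^ 2 * deriv (deriv (χ n)) y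
      set B := y * deriv (χ n) y
      set X := χ n y
      have hk : (0 : ℝ) ≤ k := Nat.cast_nonneg k
      have t1 : |2 * (2 * (k : ℝ) + 1) * B| ≤ 2 * (2 * k + 1) * C := by
        rw [abs_mul, abs_of_nonneg (by positivity : (0 : ℝ) ≤ 2 * (2 * k + 1))]
        gcongr
      have t2 : |(2 * (k : ℝ) + 1) * (2 * k) * X| ≤ (2 * k + 1) * (2 * k) * C := by
        rw [abs_mul, abs_of_nonneg (by positivity : (0 : ℝ) ≤ (2 * k + 1) * (2 * k))]
        gcongr
      have t3 : |B + (2 * (k : ℝ) + 1) * X| ≤ C + (2 * k + 1) * C := by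
        refine (abs_add_le _ _).trans (add_le_add b1 ?_)
        rw [abs_mul, abs_of_nonneg (by positivity : (0 : ℝ) ≤ 2 * k + 1)]
        gcongr
      have t4 : |(2 - y ^ 2 / 2) * (B + (2 * (k : ℝ) + 1) * X)| ≤
          2 * (1 + y ^ 2) * (C + (2 * k + 1) * C) := by
        rw [abs_mul]
        refine mul_le_mul ?_ t3 (abs_nonneg _) (by positivity)
        rw [abs_le]; constructor <;> nlinarith [sq_nonneg y]
      have t5 : |(2 + y ^ 2 * boundedPotential f y) * X| ≤ (2 + y ^ 2 * Cp) * C := by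
        rw [abs_mul]
        refine mul_le_mul ?_ b0 (abs_nonneg _) (by positivity)
        refine (abs_add_le _ _).trans ?_
        rw [abs_two, abs_mul, abs_of_nonneg (sq_nonneg y)]
        gcongr
      rw [Real.norm_eq_abs]
      have s1 := abs_add_le (-A - 2 * (2 * k + 1) * B - (2 * k + 1) * (2 * k) * X -
        (2 - y ^ 2 / 2) * (B + (2 * k + 1) * X)) ((2 + y ^ 2 * boundedPotential f y) * X)
      have s2 := abs_sub (-A - 2 * (2 * k + 1) * B - (2 * k + 1) * (2 * k) * X)
        ((2 - y ^ 2 / 2) * (B + (2 * k + 1) * X))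
      have s3 := abs_sub (-A - 2 * (2 * k + 1) * B) ((2 * k + 1) * (2 * k) * X)
      have s4 := abs_sub (-A) (2 * (2 * k + 1) * B)
      rw [abs_neg] at s4
      have hy2 : 0 ≤ y ^ 2 := sq_nonneg y
      have u1 : 0 ≤ y ^ 2 * C := by positivity
      have u2 : 0 ≤ y ^ 2 * (2 * (2 * k + 1) * C) := by positivity
      have u3 : 0 ≤ y ^ 2 * ((2 * k + 1) * (2 * k) * C) := by positivity
      have u4 : 0 ≤ Cp * C := by positivity
      calc _ ≤ C + 2 * (2 * k + 1) * C + (2 * k + 1) * (2 * k) * C +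
            2 * (1 + y ^ 2) * (C + (2 * k + 1) * C) + (2 + y ^ 2 * Cp) * C := by linarith
        _ ≤ K * (1 + y ^ 2) := by rw [hK]; nlinarith
    · filter_upwards [ae_rhoMeasure_mem] with y hy
      have hy0 : 0 < y := hy
      refine tendsto_const_nhds.congr' ?_
      filter_upwards [hχ1 y hy] with n hn
      have e1 : deriv (χ n) =ᶠ[𝓝 y] fun _ => 0 := by
        filter_upwards [hn.eventuallyEq_nhds] with z hz
        rw [hz.deriv_eq]; simp
      have e2 : deriv (deriv (χ n)) y = 0 := by rw [e1.deriv_eq]; simp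
      rw [hφ, formalOp_mul_pow f (hχd n) k hy0, e1.eq_of_nhds, e2, hn.eq_of_nhds]
      change ((((k : ℝ) + 1 / 2) * y ^ (2 * k + 1) - 2 * k * (2 * k + 3) *
        (y ^ (2 * k + 1) / y ^ 2) + boundedPotential f y * y ^ (2 * k + 1) : ℝ) : ℂ) = _
      rw [Complex.ofReal_inj]
      field_simp
      ring

end Monomials

/-! ### Independence and density of the odd monomials. -/

section Density

open scoped FourierTransform

theorem linearIndependent_oddMonomial : LinearIndependent ℂ oddMonomial := by
  rw [linearIndependent_iff']
  intro s g hg i hi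
  set P : Polynomial ℂ := ∑ i ∈ s, Polynomial.C (g i) * Polynomial.X ^ (2 * i + 1) with hP
  have hae : (fun y : ℝ => P.eval (y : ℂ)) =ᵐ[rhoMeasure] 0 := by
    have h1 := Lp.coeFn_finsetSum s fun i => g i • oddMonomial i
    rw [hg] at h1
    filter_upwards [h1, Lp.coeFn_zero ℂ 2 rhoMeasure, ae_all_iff.2 oddMonomial_ae,
      ae_all_iff.2 fun i => Lp.coeFn_smul (g i) (oddMonomial i)] with y e1 e2 e3 e4
    rw [e2] at e1
    simp only [Finset.sum_apply, e4, Pi.smul_apply, e3, smul_eq_mul] at e1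
    rw [hP, Polynomial.eval_finsetSum, e1]
    simp
  have hpos : EqOn (fun y : ℝ => P.eval (y : ℂ)) 0 (Ioi 0) :=
    Measure.eqOn_open_of_ae_eq (ae_rhoMeasure_iff.1 hae) isOpen_Ioi
      (P.continuous.comp Complex.continuous_ofReal).continuousOn continuousOn_const
  have hP0 : P = 0 := by
    refine Polynomial.eq_zero_of_infinite_isRoot P ?_
    refine ((Ioi_infinite (0 : ℝ)).image Complex.ofReal_injective.injOn).mono ?_
    rintro _ ⟨y, hy, rfl⟩
    exact hpos hy
  have hc : P.coeff (2 * i + 1) = g i := by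
    rw [hP, Polynomial.finsetSum_coeff, Finset.sum_eq_single i]
    · simp
    · intro j _ hj
      rw [Polynomial.coeff_C_mul_X_pow, if_neg (by omega)]
    · exact fun h => absurd hi h
  rw [← hc, hP0, Polynomial.coeff_zero]

theorem memLp_exp (a : ℝ) : MemLp (fun y : ℝ => Real.exp (a * y)) 2 rhoMeasure := by
  refine memLp_rhoMeasure_of_continuousOn (by fun_prop) ?_
  refine Integrable.integrableOn ?_
  refine ((integrable_pow_mul_exp (a := 1 / 8) (by norm_num) 2).const_mul
    (Real.exp (8 * a ^ 2))).mono (by unfold rho; fun_prop) (Eventually.of_forall fun y => ?_)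
  have h1 : rho y * Real.exp (a * y) ^ 2 = y ^ 2 * Real.exp (-(y ^ 2 / 4) + 2 * (a * y)) := by
    rw [rho, Real.exp_add, ← Real.exp_nat_mul]; push_cast; ring
  have h2 : Real.exp (8 * a ^ 2) * (y ^ 2 * Real.exp (-(1 / 8) * y ^ 2)) =
      y ^ 2 * Real.exp (8 * a ^ 2 + -(1 / 8) * y ^ 2) := by
    rw [Real.exp_add]; ring
  rw [h1, h2, Real.norm_of_nonneg (by positivity), Real.norm_of_nonneg (by positivity)]
  refine mul_le_mul_of_nonneg_left (Real.exp_le_exp.2 ?_) (sq_nonneg y)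
  -- This is 2ay ≤ 8a² + y²/8, which leaves half of the Gaussian decay.
  nlinarith [sq_nonneg (8 * a - y)]

/-- The sine series involves only odd moments, and these vanish. Termwise integration is allowed
because the absolute series is sinh(|ξ|y)‖g‖ ≤ exp(|ξ|y)‖g‖, a product of two L²_ρ functions. -/
theorem integral_sin_eq_zero {g : WeightedL2} (hg : ∀ k, ⟪oddMonomial k, g⟫_ℂ = 0) (ξ : ℝ) :
    ∫ y, (Real.sin (ξ * y) : ℂ) * g y ∂rhoMeasure = 0 := by
  have hmom : ∀ k, ∫ y, ((y ^ (2 * k + 1) : ℝ) : ℂ) * g y ∂rhoMeasure = 0 := fun k => by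
    rw [← hg k, L2.inner_def]
    refine integral_congr_ae ?_
    filter_upwards [oddMonomial_ae k] with y h1
    rw [h1, RCLike.inner_apply, Complex.conj_ofReal, mul_comm]
  have hsum := hasSum_integral_of_dominated_convergence (μ := rhoMeasure)
    (F := fun (k : ℕ) (y : ℝ) => (((-1) ^ k * ξ ^ (2 * k + 1) / (2 * k + 1).factorial : ℝ) : ℂ) *
      (((y ^ (2 * k + 1) : ℝ) : ℂ) * g y))
    (f := fun y => (Real.sin (ξ * y) : ℂ) * g y)
    (fun k y => (|ξ| * y) ^ (2 * k + 1) / (2 * k + 1).factorial * ‖g y‖)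
    (fun k => ?_) (fun k => ?_) ?_ ?_ ?_
  · have h0 : ∀ k : ℕ, ∫ y, (((-1) ^ k * ξ ^ (2 * k + 1) / (2 * k + 1).factorial : ℝ) : ℂ) *
      (((y ^ (2 * k + 1) : ℝ) : ℂ) * g y) ∂rhoMeasure = 0 := fun k => by
      rw [integral_const_mul, hmom, mul_zero]
    simp_rw [h0] at hsum
    exact hsum.unique hasSum_zero
  · exact (((by fun_prop : Continuous fun y : ℝ => ((y ^ (2 * k + 1) : ℝ) :
      ℂ)).aestronglyMeasurable).mul (Lp.aestronglyMeasurable g)).const_mul _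
  · filter_upwards [ae_rhoMeasure_mem] with y hy
    have hy0 : 0 < y := hy
    rw [norm_mul, norm_mul, Complex.norm_real, Complex.norm_real, norm_div, norm_mul, norm_pow,
      norm_pow, norm_neg, norm_one, one_pow, one_mul, norm_pow, Real.norm_eq_abs,
      Real.norm_of_nonneg hy0.le, mul_pow, Real.norm_of_nonneg (by positivity)]
    apply le_of_eq; ring
  · filter_upwards [] with y
    exact (Real.hasSum_sinh (|ξ| * y)).summable.mul_right _
  · have hmeas : AEStronglyMeasurable (fun y : ℝ => Real.sinh (|ξ| * y)) rhoMeasure :=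
      (by fun_prop : Continuous fun y : ℝ => Real.sinh (|ξ| * y)).aestronglyMeasurable
    have h1 : Integrable (fun y => Real.exp (|ξ| * y) * ‖g y‖) rhoMeasure :=
      (memLp_exp |ξ|).integrable_mul (Lp.memLp g).norm
    have e : ∀ y, ∑' k : ℕ, (|ξ| * y) ^ (2 * k + 1) / (2 * k + 1).factorial * ‖g y‖ =
        Real.sinh (|ξ| * y) * ‖g y‖ := fun y =>
      ((Real.hasSum_sinh (|ξ| * y)).mul_right _).tsum_eq
    simp_rw [e]
    refine h1.mono (hmeas.mul (Lp.aestronglyMeasurable g).norm) ?_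
    filter_upwards [ae_rhoMeasure_mem] with y hy
    have hy0 : 0 < y := hy
    have hp : 0 ≤ |ξ| * y := by positivity
    rw [norm_mul, norm_mul, Real.norm_of_nonneg (Real.sinh_nonneg_iff.2 hp),
      Real.norm_of_nonneg (Real.exp_pos _).le]
    refine mul_le_mul_of_nonneg_right ?_ (norm_nonneg _)
    rw [Real.sinh_eq]
    linarith [Real.exp_pos (|ξ| * y), Real.exp_pos (-(|ξ| * y))]
  · filter_upwards [] with y
    have h1 := ((Complex.hasSum_ofReal.2 (Real.hasSum_sin (ξ * y))).mul_right (g y))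
    convert! h1 using 2 with k
    push_cast
    ring

/-- A function on the half-line with vanishing sine transform is zero. -/
theorem ae_eq_zero_of_sine_transform {h : ℝ → ℂ} (hi : IntegrableOn h (Ioi 0))
    (hs : ∀ ξ : ℝ, ∫ y in Ioi 0, (Real.sin (ξ * y) : ℂ) * h y = 0) :
    ∀ᵐ y ∂volume.restrict (Ioi (0 : ℝ)), h y = 0 := by
  rw [ae_restrict_iff' measurableSet_Ioi]
  refine isOpen_Ioi.ae_eq_zero_of_integral_contDiff_smul_eq_zero
    hi.locallyIntegrableOn fun ψ hψ hψc hψs => ?_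
  have hψ0 : ∀ y, y ≤ 0 → ψ y = 0 := fun y hy =>
    image_eq_zero_of_notMem_tsupport fun h' => not_lt.2 hy (hψs h')
  have hΨc : HasCompactSupport (Complex.ofRealCLM ∘ ψ) := hψc.comp_left rfl
  have hΨd : ContDiff ℝ ∞ (Complex.ofRealCLM ∘ ψ) := Complex.ofRealCLM.contDiff.comp hψ
  set Ψ : SchwartzMap ℝ ℂ := hΨc.toSchwartzMap hΨd with hΨ
  have hΨa : ∀ y, Ψ y = ψ y := fun y => rfl
  set Φ : SchwartzMap ℝ ℂ := 𝓕⁻ Ψ with hΦ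
  have hΦi : Integrable Φ := Φ.integrable
  have hfour : ∀ y : ℝ, (ψ y : ℂ) =
      ∫ x : ℝ, Complex.exp (↑(-2 * Real.pi * x * y) * Complex.I) * Φ x := by
    intro y
    have h1 : 𝓕 Φ = Ψ := FourierTransform.fourier_fourierInv_eq Ψ
    rw [← hΨa, ← h1, SchwartzMap.fourier_coe, Real.fourier_eq']
    refine integral_congr_ae (Eventually.of_forall fun x => ?_)
    have e : -2 * Real.pi * x * y = -2 * Real.pi * ⟪x, y⟫_ℝ := by
      simp only [RCLike.inner_apply, conj_trivial]; ring
    simp only [smul_eq_mul, e]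
  have hexp : ∀ y : ℝ, Integrable fun x : ℝ =>
      Complex.exp (↑(-2 * Real.pi * x * y) * Complex.I) * Φ x := fun y =>
    hΦi.bdd_mul (c := 1) (by fun_prop) (Eventually.of_forall fun x => by
      rw [Complex.norm_exp_ofReal_mul_I])
  -- For y > 0 the test function equals ψ(y) - ψ(-y), so Fourier inversion writes it as a
  -- superposition of sines. Fubini then reduces its pairing with `h` to the sine transform of `h`.
  have hsin : ∀ y ∈ Ioi (0 : ℝ), (ψ y : ℂ) =
      ∫ x : ℝ, (-2 * Complex.I * Φ x) * (Real.sin (2 * Real.pi * x * y) : ℂ) := by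
    intro y hy
    have h1 : (ψ y : ℂ) = ψ y - ψ (-y) := by
      rw [hψ0 (-y) (by simpa using le_of_lt hy)]; simp
    rw [h1, hfour y, hfour (-y), ← integral_sub (hexp y) (hexp (-y))]
    refine integral_congr_ae (Eventually.of_forall fun x => ?_)
    have e1 : ((-2 * Real.pi * x * y : ℝ) : ℂ) = -((2 * Real.pi * x * y : ℝ) : ℂ) := by
      push_cast; ring
    have e2 : ((-2 * Real.pi * x * (-y) : ℝ) : ℂ) = ((2 * Real.pi * x * y : ℝ) : ℂ) := by
      push_cast; ring
    simp only [e1, e2]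
    rw [Complex.exp_mul_I, Complex.exp_mul_I, Complex.cos_neg, Complex.sin_neg,
      Complex.ofReal_sin]
    ring
  have hint : Integrable (Function.uncurry fun (y x : ℝ) =>
      (-2 * Complex.I * Φ x) * (Real.sin (2 * Real.pi * x * y) : ℂ) * h y)
      ((volume.restrict (Ioi (0 : ℝ))).prod volume) := by
    have h1 : Integrable (fun p : ℝ × ℝ => h p.1 * (-2 * Complex.I * Φ p.2))
        ((volume.restrict (Ioi (0 : ℝ))).prod volume) := Integrable.mul_prod hi (hΦi.const_mul _)
    have h2 := h1.bdd_mul (c := 1)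
      (f := fun p : ℝ × ℝ => (Real.sin (2 * Real.pi * p.2 * p.1) : ℂ))
      (by fun_prop) (Eventually.of_forall fun p => by
        rw [Complex.norm_real]; exact Real.abs_sin_le_one _)
    refine h2.congr (Eventually.of_forall fun p => ?_)
    simp only [Function.uncurry]
    ring
  calc ∫ y, ψ y • h y = ∫ y in Ioi 0, ψ y • h y := by
        refine (setIntegral_eq_integral_of_forall_compl_eq_zero fun y hy => ?_).symm
        rw [hψ0 y (by simpa using hy), zero_smul]
    _ = ∫ y in Ioi (0 : ℝ), ∫ x : ℝ,
        (-2 * Complex.I * Φ x) * (Real.sin (2 * Real.pi * x * y) : ℂ) * h y := by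
        refine setIntegral_congr_fun measurableSet_Ioi fun y hy => ?_
        rw [integral_mul_const, ← hsin y hy, Complex.real_smul]
    _ = ∫ x : ℝ, ∫ y in Ioi (0 : ℝ),
        (-2 * Complex.I * Φ x) * (Real.sin (2 * Real.pi * x * y) : ℂ) * h y :=
        integral_integral_swap hint
    _ = 0 := by
        have e : ∀ x : ℝ, ∫ y in Ioi (0 : ℝ),
            (-2 * Complex.I * Φ x) * (Real.sin (2 * Real.pi * x * y) : ℂ) * h y = 0 := fun x => by
          rw [← mul_zero (-2 * Complex.I * Φ x), ← hs (2 * Real.pi * x), ← integral_const_mul]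
          exact integral_congr_ae (Eventually.of_forall fun y => mul_assoc _ _ _)
        exact (integral_congr_ae (Eventually.of_forall e)).trans (by simp)

/-- Odd polynomials are dense in `L²_ρ`. -/
theorem dense_span_oddMonomial :
    Dense (Submodule.span ℂ (range oddMonomial) : Set WeightedL2) := by
  rw [Submodule.dense_iff_topologicalClosure_eq_top, Submodule.topologicalClosure_eq_top_iff,
    Submodule.eq_bot_iff]
  intro g hg
  have hg' : ∀ k, ⟪oddMonomial k, g⟫_ℂ = 0 := fun k =>
    hg _ (Submodule.subset_span (mem_range_self k))
  have h1 : Integrable g rhoMeasure := by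
    have := (memLp_exp 0).integrable_mul (Lp.memLp g).norm
    refine this.mono (Lp.aestronglyMeasurable g) (Eventually.of_forall fun y => ?_)
    simp
  have h2 := ae_eq_zero_of_sine_transform (integrable_rhoMeasure_iff.1 h1) fun ξ => by
    rw [← integral_sin_eq_zero hg' ξ, integral_rhoMeasure]
    simp_rw [Complex.real_smul]
    congr 1; ext y; ring
  rw [Lp.eq_zero_iff_ae_eq_zero, EventuallyEq, ae_rhoMeasure_iff]
  filter_upwards [h2, ae_restrict_mem measurableSet_Ioi] with y h3 hy
  exact (smul_eq_zero.1 h3).resolve_left (rho_pos hy).ne'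

theorem not_finiteDimensional_weightedL2 : ¬ FiniteDimensional ℂ WeightedL2 := fun _ =>
  not_finite_iff_infinite.2 (inferInstance : Infinite ℕ) linearIndependent_oddMonomial.finite

end Density

/-! ### Dense domain and compact inverse for the operator. -/

section Assembly

variable {f : ℝ → ℝ}

/-- First components of the closed graph lie in the closure of the domain, and they include all odd
monomials. -/
theorem dense_domain_opA (hf : IsSelfSimilarProfile f) :
    Dense ((opA f hf).domain : Set WeightedL2) := by
  rw [Submodule.dense_iff_topologicalClosure_eq_top, eq_top_iff]
  have h1 : Submodule.span ℂ (range oddMonomial) ≤ (opA f hf).domain.topologicalClosure := by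
    rw [Submodule.span_le]
    rintro _ ⟨k, rfl⟩
    refine map_mem_closure (f := Prod.fst) continuous_fst (oddMonomial_mem_closure_graph hf k) ?_
    rintro p hp
    obtain ⟨x, hx, -⟩ := (LinearPMap.mem_graph_iff _).1 hp
    rw [← hx]; exact x.2
  have h2 := Submodule.topologicalClosure_minimal _ h1 (Submodule.isClosed_topologicalClosure _)
  rwa [(Submodule.dense_iff_topologicalClosure_eq_top).1 dense_span_oddMonomial] at h2

theorem exists_compact_inverse (hf : IsSelfSimilarProfile f) :
    ∃ c : ℝ, ∃ R : WeightedL2 →L[ℂ] WeightedL2, IsCompactOperator R ∧ ∀ u,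
      (R u, u - (c : ℂ) • R u) ∈ closure ((opA f hf).graph : Set (WeightedL2 × WeightedL2)) := by
  obtain ⟨C, hC⟩ := hf.exists_boundedPotential_le
  obtain ⟨W, hW⟩ := exists_mul_clm (aestronglyMeasurable_rhoMeasure_of_continuousOn
    hf.continuousOn_boundedPotential) hC
  let Λ : WeightedL2 × WeightedL2 →L[ℂ] WeightedL2 × WeightedL2 :=
    (ContinuousLinearMap.fst ℂ WeightedL2 WeightedL2).prod
      (ContinuousLinearMap.snd ℂ WeightedL2 WeightedL2 +
        W ∘L ContinuousLinearMap.fst ℂ WeightedL2 WeightedL2)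
  have hΛ : ∀ p, Λ p = (p.1, p.2 + W p.1) := fun p => rfl
  -- The closed graph with the bounded potential subtracted, on which the odd monomials are exactly
  -- triangular.
  let G : Submodule ℂ (WeightedL2 × WeightedL2) :=
    (opA f hf).graph.topologicalClosure.comap (Λ : _ →ₗ[ℂ] _)
  have hG : ∀ p, p ∈ G ↔
      (p.1, p.2 + W p.1) ∈ closure ((opA f hf).graph : Set (WeightedL2 × WeightedL2)) :=
    fun p => Iff.rfl
  have hGc : IsClosed (G : Set (WeightedL2 × WeightedL2)) :=
    (Submodule.isClosed_topologicalClosure _).preimage Λ.continuous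
  have hGs : ∀ x ∈ G, ∀ y ∈ G, ⟪x.2, y.1⟫_ℂ = ⟪x.1, y.2⟫_ℂ := by
    intro x hx y hy
    have h := UnboundedOp.symmetric_of_mem_closure
      (UnboundedOp.graph_symmetric (opA_isFormalAdjoint f hf)) ((hG x).1 hx) ((hG y).1 hy)
    simp only [inner_add_left, inner_add_right] at h
    rw [mul_clm_symmetric hW] at h
    exact add_right_cancel h
  have htri : ∀ k : ℕ, ∃ q ∈ Submodule.span ℂ (oddMonomial '' Iio k),
      (oddMonomial k, (((k : ℝ) + 1 / 2 : ℝ) : ℂ) • oddMonomial k + q) ∈ G := by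
    intro k
    -- For k = 0 the truncated index k - 1 is harmless, since the coefficient vanishes.
    set q : WeightedL2 := -(((2 * k * (2 * k + 3) : ℝ) : ℂ) • oddMonomial (k - 1)) with hq
    refine ⟨q, ?_, (hG _).2 ?_⟩
    · rcases Nat.eq_zero_or_pos k with rfl | hk
      · rw [hq]; simp
      · exact neg_mem (Submodule.smul_mem _ _
          (Submodule.subset_span ⟨k - 1, Nat.sub_lt hk one_pos, rfl⟩))
    · convert oddMonomial_mem_closure_graph hf k using 2
      refine Lp.ext ?_
      filter_upwards [ae_rhoMeasure_mem, MemLp.coeFn_toLp ((memLp_formalOp_pow hf k).ofReal (K := ℂ)),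
        hW (oddMonomial k), oddMonomial_ae k, oddMonomial_ae (k - 1),
        Lp.coeFn_add ((((k : ℝ) + 1 / 2 : ℝ) : ℂ) • oddMonomial k + q) (W (oddMonomial k)),
        Lp.coeFn_add ((((k : ℝ) + 1 / 2 : ℝ) : ℂ) • oddMonomial k) q,
        Lp.coeFn_smul (((k : ℝ) + 1 / 2 : ℝ) : ℂ) (oddMonomial k),
        Lp.coeFn_neg (((2 * k * (2 * k + 3) : ℝ) : ℂ) • oddMonomial (k - 1)),
        Lp.coeFn_smul ((2 * k * (2 * k + 3) : ℝ) : ℂ) (oddMonomial (k - 1))]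
        with y hy e1 e2 e3 e4 e5 e6 e7 e8 e9
      rw [e1, e5, Pi.add_apply, e6, Pi.add_apply, e7, e8, Pi.neg_apply, e9, e2, Pi.smul_apply,
        Pi.smul_apply, e3, e4, smul_eq_mul, smul_eq_mul, Complex.real_smul]
      have hy0 : y ≠ 0 := ne_of_gt hy
      have key : (2 * k * (2 * k + 3) : ℝ) * (y ^ (2 * k + 1) / y ^ 2) =
          2 * k * (2 * k + 3) * y ^ (2 * (k - 1) + 1) := by
        rcases Nat.eq_zero_or_pos k with rfl | hk
        · simp
        · obtain ⟨j, rfl⟩ := Nat.exists_eq_add_of_le' hk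
          rw [Nat.add_sub_cancel]
          field_simp
          ring
      rw [key]
      change _ = ((_ : ℝ) : ℂ)
      norm_cast
  obtain ⟨R, hRK, hR⟩ := UnboundedOp.exists_compact_inverse_of_triangular hGc hGs
    linearIndependent_oddMonomial dense_span_oddMonomial htri W
  refine ⟨‖W‖, R, hRK, fun u => ?_⟩
  have h := (hG _).1 (hR u)
  rwa [sub_add_cancel] at h

end Assembly

/-! ### Regularity of elements of the domain of the closure. -/

section Flux

/-- The integral of `t ρ(t) h(t)` over `(0, x)`. -/
noncomputable def flux (h : WeightedL2) (x : ℝ) : ℂ :=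
  ∫ t in (0 : ℝ)..x, (Ioi (0 : ℝ)).indicator (fun t => (t * rho t) • h t) t

theorem integrable_fluxDensity (h : WeightedL2) :
    Integrable ((Ioi (0 : ℝ)).indicator fun t => (t * rho t) • h t) := by
  rw [integrable_indicator_iff measurableSet_Ioi]
  have h1 : Integrable (fun t => ((t ^ (2 * 0 + 1) : ℝ) : ℂ) * h t) rhoMeasure :=
    ((memLp_pow (2 * 0 + 1)).ofReal (K := ℂ)).integrable_mul (Lp.memLp h)
  refine (integrable_rhoMeasure_iff.1 h1).congr (Eventually.of_forall fun t => ?_)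
  simp only [Complex.real_smul]
  push_cast
  ring

theorem continuous_flux (h : WeightedL2) : Continuous (flux h) :=
  intervalIntegral.continuous_primitive
    (fun _ _ => (integrable_fluxDensity h).intervalIntegrable) 0

theorem flux_eq_of_ae {h : WeightedL2} {k : ℝ → ℂ} (hk : h =ᵐ[rhoMeasure] k) {x : ℝ}
    (hx : 0 < x) : flux h x = ∫ t in (0 : ℝ)..x, (t * rho t) • k t := by
  refine intervalIntegral.integral_congr_ae ?_
  filter_upwards [(ae_restrict_iff' measurableSet_Ioi).1 (ae_rhoMeasure_iff.1 hk)] with t ht htx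
  rw [uIoc_of_le hx.le] at htx
  rw [indicator_of_mem (mem_Ioi.2 htx.1), ht htx.1]

theorem flux_sub (h k : WeightedL2) (x : ℝ) : flux (h - k) x = flux h x - flux k x := by
  rw [flux, flux, flux, ← intervalIntegral.integral_sub
    (integrable_fluxDensity h).intervalIntegrable (integrable_fluxDensity k).intervalIntegrable]
  refine intervalIntegral.integral_congr_ae ?_
  filter_upwards [(ae_restrict_iff' measurableSet_Ioi).1
    (ae_rhoMeasure_iff.1 (Lp.coeFn_sub h k))] with t ht _
  by_cases h0 : t ∈ Ioi (0 : ℝ)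
  · simp only [indicator_of_mem h0]
    rw [ht h0, Pi.sub_apply, smul_sub]
  · simp only [indicator_of_notMem h0, sub_zero]

/-- Cauchy-Schwarz against t on (0, x], whose squared norm is ∫ t² ρ ≤ x · x⁴ because ρ(t) ≤ t². -/
theorem norm_flux_sq_le (h : WeightedL2) {x : ℝ} (hx : 0 < x) :
    ‖flux h x‖ ^ 2 ≤ x ^ 5 * ‖h‖ ^ 2 := by
  have hm : MemLp ((Ioc 0 x).indicator fun t : ℝ => ((t ^ (2 * 0 + 1) : ℝ) : ℂ)) 2 rhoMeasure :=
    ((memLp_pow (2 * 0 + 1)).ofReal (K := ℂ)).indicator measurableSet_Ioc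
  set e : WeightedL2 := hm.toLp _ with he
  have hIoc : Ioi (0 : ℝ) ∩ Ioc 0 x = Ioc 0 x := inter_eq_right.2 fun t ht => ht.1
  have h1 : ⟪e, h⟫_ℂ = flux h x := by
    have a1 : ⟪e, h⟫_ℂ = ∫ t, (Ioc 0 x).indicator (fun t => (t : ℂ) * h t) t ∂rhoMeasure := by
      rw [L2.inner_def]
      refine integral_congr_ae ?_
      filter_upwards [hm.coeFn_toLp] with t ht
      rw [he, ht]
      by_cases h0 : t ∈ Ioc 0 x
      · simp [indicator_of_mem h0, RCLike.inner_apply, mul_comm]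
      · simp [indicator_of_notMem h0]
    rw [a1, integral_rhoMeasure]
    have a2 : (fun t => rho t • (Ioc 0 x).indicator (fun t => (t : ℂ) * h t) t) =
        (Ioc 0 x).indicator fun t => (t * rho t) • h t := by
      funext t
      by_cases h0 : t ∈ Ioc 0 x
      · simp only [indicator_of_mem h0, Complex.real_smul]
        push_cast; ring
      · simp only [indicator_of_notMem h0, smul_zero]
    rw [a2, setIntegral_indicator measurableSet_Ioc, hIoc,
      flux_eq_of_ae (EventuallyEq.refl _ _) hx, intervalIntegral.integral_of_le hx.le]
  have h2 : ‖e‖ ^ 2 ≤ x ^ 5 := by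
    have a1 : ((‖e‖ ^ 2 : ℝ) : ℂ) =
        ∫ t, (((Ioc 0 x).indicator (fun t => t ^ 2) t : ℝ) : ℂ) ∂rhoMeasure := by
      have := inner_self_eq_norm_sq_to_K (𝕜 := ℂ) e
      push_cast
      refine this.symm.trans ?_
      rw [L2.inner_def]
      refine integral_congr_ae ?_
      filter_upwards [hm.coeFn_toLp] with t ht
      rw [he, ht]
      by_cases h0 : t ∈ Ioc 0 x
      · simp only [indicator_of_mem h0, RCLike.inner_apply, Complex.conj_ofReal]
        push_cast
        ring
      · simp [indicator_of_notMem h0]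
    rw [integral_complex_ofReal, Complex.ofReal_inj] at a1
    rw [a1, integral_rhoMeasure]
    have a2 : (fun t => rho t • (Ioc 0 x).indicator (fun t : ℝ => t ^ 2) t) =
        (Ioc 0 x).indicator fun t => rho t * t ^ 2 := by
      funext t
      by_cases h0 : t ∈ Ioc 0 x
      · simp only [indicator_of_mem h0, smul_eq_mul]
      · simp only [indicator_of_notMem h0, smul_zero]
    rw [a2, setIntegral_indicator measurableSet_Ioc, hIoc, ← intervalIntegral.integral_of_le hx.le]
    refine (le_abs_self _).trans ?_
    have := intervalIntegral.norm_integral_le_of_norm_le_const (a := 0) (b := x) (C := x ^ 4)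
      (f := fun t => rho t * t ^ 2) (fun t ht => by
        rw [uIoc_of_le hx.le] at ht
        rw [norm_mul, Real.norm_of_nonneg (rho_nonneg t), Real.norm_of_nonneg (sq_nonneg t)]
        have b1 : rho t ≤ x ^ 2 := by
          have c1 : Real.exp (-(t ^ 2 / 4)) ≤ 1 :=
            Real.exp_le_one_iff.2 (by nlinarith [sq_nonneg t])
          have c2 : t ^ 2 ≤ x ^ 2 := pow_le_pow_left₀ ht.1.le ht.2 2
          rw [rho]
          nlinarith [sq_nonneg t, Real.exp_pos (-(t ^ 2 / 4))]
        have b2 : t ^ 2 ≤ x ^ 2 := pow_le_pow_left₀ ht.1.le ht.2 2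
        calc rho t * t ^ 2 ≤ x ^ 2 * x ^ 2 := mul_le_mul b1 b2 (sq_nonneg t) (sq_nonneg x)
          _ = x ^ 4 := by ring)
    refine this.trans (le_of_eq ?_)
    rw [sub_zero, abs_of_pos hx]; ring
  rw [← h1]
  calc ‖⟪e, h⟫_ℂ‖ ^ 2 ≤ (‖e‖ * ‖h‖) ^ 2 :=
        pow_le_pow_left₀ (norm_nonneg _) (norm_inner_le_norm _ _) 2
    _ = ‖e‖ ^ 2 * ‖h‖ ^ 2 := mul_pow _ _ _
    _ ≤ _ := mul_le_mul_of_nonneg_right h2 (sq_nonneg _)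

/-- The derivative of `u(y)/y` in terms of the flux. -/
noncomputable def quotDeriv (h : WeightedL2) (x : ℝ) : ℂ :=
  -((1 / (x ^ 2 * rho x)) • flux h x)

theorem continuousOn_quotDeriv (h : WeightedL2) : ContinuousOn (quotDeriv h) (Ioi 0) := by
  have h1 : ContinuousOn (fun x : ℝ => 1 / (x ^ 2 * rho x)) (Ioi 0) :=
    continuousOn_const.div ((by fun_prop : Continuous fun x : ℝ => x ^ 2).mul
      continuous_rho).continuousOn fun x hx =>
      (mul_pos (pow_pos hx 2) (rho_pos hx)).ne'
  exact (h1.smul (continuous_flux h).continuousOn).neg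

theorem uIcc_one_subset {x : ℝ} (hx : 0 < x) : uIcc 1 x ⊆ Ioi (0 : ℝ) := fun _ ht =>
  lt_of_lt_of_le (lt_min one_pos hx) ht.1

theorem intervalIntegrable_quotDeriv (h : WeightedL2) {x : ℝ} (hx : 0 < x) :
    IntervalIntegrable (quotDeriv h) volume 1 x :=
  ((continuousOn_quotDeriv h).mono (uIcc_one_subset hx)).intervalIntegrable

/-- The flux bound controls `quotDeriv` uniformly between 1 and x by the L²_ρ norm. This carries the
identity for test functions over to the closure. -/
theorem tendsto_integral_quotDeriv {h : ℕ → WeightedL2} {k : WeightedL2}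
    (hk : Tendsto h atTop (𝓝 k)) {x : ℝ} (hx : 0 < x) :
    Tendsto (fun n => ∫ s in (1 : ℝ)..x, quotDeriv (h n) s) atTop
      (𝓝 (∫ s in (1 : ℝ)..x, quotDeriv k s)) := by
  have hc : ContinuousOn (fun s : ℝ => 1 / (s ^ 2 * rho s) * Real.sqrt (s ^ 5)) (uIcc 1 x) := by
    refine ContinuousOn.mul ?_ (by fun_prop)
    exact continuousOn_const.div ((by fun_prop : Continuous fun x : ℝ => x ^ 2).mul
      continuous_rho).continuousOn fun s hs =>
      (mul_pos (pow_pos (uIcc_one_subset hx hs) 2) (rho_pos (uIcc_one_subset hx hs))).ne'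
  obtain ⟨M, hM⟩ := isCompact_uIcc.exists_bound_of_continuousOn hc
  rw [tendsto_iff_norm_sub_tendsto_zero]
  have hlim : Tendsto (fun n => M * ‖h n - k‖ * |x - 1|) atTop (𝓝 0) := by
    simpa using ((tendsto_iff_norm_sub_tendsto_zero.1 hk).const_mul M).mul_const |x - 1|
  refine squeeze_zero (fun _ => norm_nonneg _) (fun n => ?_) hlim
  rw [← intervalIntegral.integral_sub (intervalIntegrable_quotDeriv _ hx)
    (intervalIntegrable_quotDeriv _ hx)]
  refine intervalIntegral.norm_integral_le_of_norm_le_const fun s hs => ?_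
  have hs' := uIoc_subset_uIcc hs
  have hs0 : 0 < s := uIcc_one_subset hx hs'
  have e : quotDeriv (h n) s - quotDeriv k s = -((1 / (s ^ 2 * rho s)) • flux (h n - k) s) := by
    rw [quotDeriv, quotDeriv, flux_sub, smul_sub]; abel
  have hfl : ‖flux (h n - k) s‖ ≤ Real.sqrt (s ^ 5) * ‖h n - k‖ := by
    refine le_of_sq_le_sq ?_ (by positivity)
    rw [mul_pow, Real.sq_sqrt (by positivity)]
    exact norm_flux_sq_le _ hs0
  have hpos : 0 ≤ 1 / (s ^ 2 * rho s) := by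
    have := rho_nonneg s
    positivity
  rw [e, norm_neg, norm_smul, Real.norm_of_nonneg hpos]
  calc _ ≤ 1 / (s ^ 2 * rho s) * (Real.sqrt (s ^ 5) * ‖h n - k‖) := by gcongr
    _ = 1 / (s ^ 2 * rho s) * Real.sqrt (s ^ 5) * ‖h n - k‖ := by ring
    _ ≤ M * ‖h n - k‖ := by
      gcongr
      exact (le_abs_self _).trans (hM s hs')

/-- Here h = (L - 1/2)φ. As L y = y/2, dividing by y removes the zeroth-order term: (y²ρ(φ/y)')' =
-yρh. Integrating from 0, where φ vanishes, identifies y²ρ(φ/y)' with minus the flux. -/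
theorem testFunction_div_eq {f : ℝ → ℝ} (φ : 𝓓(halfLine, ℂ)) {h : WeightedL2}
    (hh : h =ᵐ[rhoMeasure] fun y => formalOp f φ y - (boundedPotential f y + 1 / 2) • φ y)
    {x : ℝ} (hx : 0 < x) :
    (1 / x) • φ x = φ 1 + ∫ s in (1 : ℝ)..x, quotDeriv h s := by
  set a : ℝ → ℂ := fun x => rho x • deriv φ x with ha
  have had : ContDiff ℝ ∞ a := contDiff_rho_deriv φ
  have h1 : ∀ y, HasDerivAt φ (deriv φ y) y := fun y =>
    (φ.contDiff.differentiable (by simp) y).hasDerivAt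
  have h2 : ∀ y, HasDerivAt a (deriv a y) y := fun y => (had.differentiable (by simp) y).hasDerivAt
  have hflux : ∀ s, 0 < s → flux h s = -(s • a s - rho s • φ s) := by
    intro s hs
    have hd : ∀ t ∈ Ioo 0 s, HasDerivAt (fun t => s • (0 : ℂ) - (t • a t - rho t • φ t))
        ((t * rho t) • (formalOp f φ t - (boundedPotential f t + 1 / 2) • φ t)) t := by
      intro t ht
      have ht0 : t ≠ 0 := ht.1.ne'
      have h3 := (((hasDerivAt_id t).smul (h2 t)).sub
        ((hasDerivAt_rho ht0).smul (h1 t))).const_sub (s • (0 : ℂ))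
      refine h3.congr_deriv ?_
      have e : (t * rho t) • formalOp f φ t = t • (-deriv a t +
        (rho t * (2 / t ^ 2 + boundedPotential f t)) • φ t) := by
        rw [mul_smul, formalOp_of_pos f φ ht.1, potential_eq f ht.1]
      rw [smul_sub, e]
      have e2 : ((2 / t - t / 2) * rho t : ℝ) = t * (rho t * (2 / t ^ 2 - 1 / 2)) := by
        field_simp
      rw [e2]
      simp only [id, ha, Complex.real_smul]
      push_cast
      ring
    have hcont : ContinuousOn (fun t => s • (0 : ℂ) - (t • a t - rho t • φ t)) (Icc 0 s) := by
      have c1 := had.continuous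
      have c2 := continuous_rho
      have c3 := φ.continuous
      fun_prop
    rw [flux_eq_of_ae hh hs, intervalIntegral.integral_eq_sub_of_hasDerivAt_of_le hs.le hcont hd]
    · simp [testFunction_apply_zero]
    · rw [intervalIntegrable_iff_integrableOn_Ioc_of_le hs.le]
      refine ((integrable_fluxDensity h).integrableOn (s := Ioc 0 s)).congr_fun_ae ?_
      rw [EventuallyEq, ae_restrict_iff' measurableSet_Ioc]
      filter_upwards [(ae_restrict_iff' measurableSet_Ioi).1 (ae_rhoMeasure_iff.1 hh)] with t ht htx
      rw [indicator_of_mem (mem_Ioi.2 htx.1), ht htx.1]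
  have hd : ∀ s ∈ uIcc 1 x, HasDerivAt (fun s : ℝ => (1 / s) • φ s) (quotDeriv h s) s := by
    intro s hs
    have hs0 : 0 < s := uIcc_one_subset hx hs
    have h3 : HasDerivAt (fun s : ℝ => 1 / s) (-(1 / s ^ 2)) s := by
      simpa using hasDerivAt_inv hs0.ne'
    refine (h3.smul (h1 s)).congr_deriv ?_
    rw [quotDeriv, hflux s hs0]
    have hr := (rho_pos hs0).ne'
    simp only [ha, smul_sub, smul_neg, neg_neg, smul_smul, neg_smul, ← sub_eq_add_neg]
    have e1 : 1 / (s ^ 2 * rho s) * (s * rho s) = 1 / s := by field_simp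
    have e2 : 1 / (s ^ 2 * rho s) * rho s = 1 / s ^ 2 := by field_simp
    rw [e1, e2]
  rw [intervalIntegral.integral_eq_sub_of_hasDerivAt hd (intervalIntegrable_quotDeriv h hx)]
  simp

/-- Elements of the domain of the closure are continuously differentiable, with an explicit
derivative. -/
theorem exists_regular_representative {f : ℝ → ℝ} (hf : IsSelfSimilarProfile f)
    {W : WeightedL2 →L[ℂ] WeightedL2}
    (hW : ∀ u : WeightedL2, W u =ᵐ[rhoMeasure] fun y => boundedPotential f y • u y)
    {u g : WeightedL2}
    (hug : (u, g) ∈ closure ((opA f hf).graph : Set (WeightedL2 × WeightedL2))) :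
    ∃ v : ℝ → ℂ, (∀ y, 0 < y → HasDerivAt v (quotDeriv (g - W u - (1 / 2 : ℂ) • u) y) y) ∧
      u =ᵐ[rhoMeasure] fun y => y • v y := by
  set h : WeightedL2 := g - W u - (1 / 2 : ℂ) • u with hh
  obtain ⟨p, hp, hlim⟩ := mem_closure_iff_seq_limit.1 hug
  choose φ hφ using fun n => (mem_graph_opA_iff f hf (p n)).1 (hp n)
  have hl1 : Tendsto (fun n => testToL2 (φ n)) atTop (𝓝 u) := by
    have := (continuous_fst.tendsto _).comp hlim
    refine this.congr fun n => ?_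
    simp [← hφ n]
  have hl2 : Tendsto (fun n => formalOpToL2 f hf (φ n)) atTop (𝓝 g) := by
    have := (continuous_snd.tendsto _).comp hlim
    refine this.congr fun n => ?_
    simp [← hφ n]
  set hn : ℕ → WeightedL2 := fun n =>
    formalOpToL2 f hf (φ n) - W (testToL2 (φ n)) - (1 / 2 : ℂ) • testToL2 (φ n) with hhn
  have hl3 : Tendsto hn atTop (𝓝 h) :=
    (hl2.sub ((W.continuous.tendsto u).comp hl1)).sub (hl1.const_smul _)
  have hnae : ∀ n, hn n =ᵐ[rhoMeasure]
      fun y => formalOp f (φ n) y - (boundedPotential f y + 1 / 2) • φ n y := by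
    intro n
    filter_upwards [Lp.coeFn_sub (formalOpToL2 f hf (φ n) - W (testToL2 (φ n)))
      ((1 / 2 : ℂ) • testToL2 (φ n)),
      Lp.coeFn_sub (formalOpToL2 f hf (φ n)) (W (testToL2 (φ n))),
      Lp.coeFn_smul (1 / 2 : ℂ) (testToL2 (φ n)), hW (testToL2 (φ n)),
      (memLp_formalOp hf (φ n)).coeFn_toLp, (memLp_test (φ n)).coeFn_toLp]
      with y e1 e2 e3 e4 e5 e6
    rw [hhn, e1, Pi.sub_apply, e2, Pi.sub_apply, e3, Pi.smul_apply, e4]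
    change (formalOpToL2 f hf (φ n)) y = _ at e5
    change (testToL2 (φ n)) y = _ at e6
    rw [e5, e6]
    simp only [Complex.real_smul, smul_eq_mul]
    push_cast
    ring
  obtain ⟨ns, hns, hae⟩ := (tendstoInMeasure_of_tendsto_Lp hl1).exists_seq_tendsto_ae
  have hae2 : ∀ᵐ y ∂volume.restrict (Ioi (0 : ℝ)),
      0 < y ∧ Tendsto (fun i => φ (ns i) y) atTop (𝓝 (u y)) := by
    rw [← ae_rhoMeasure_iff]
    filter_upwards [ae_rhoMeasure_mem, hae,
      ae_all_iff.2 fun n => (memLp_test (φ n)).coeFn_toLp] with y hy h1 h2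
    refine ⟨hy, h1.congr fun i => h2 (ns i)⟩
  have hFlim : ∀ y, 0 < y → Tendsto (fun i => ∫ s in (1 : ℝ)..y, quotDeriv (hn (ns i)) s) atTop
      (𝓝 (∫ s in (1 : ℝ)..y, quotDeriv h s)) := fun y hy =>
    (tendsto_integral_quotDeriv hl3 hy).comp hns.tendsto_atTop
  have hne : (ae (volume.restrict (Ioi (0 : ℝ)))).NeBot := by
    rw [ae_neBot, Ne, Measure.restrict_eq_zero]; simp
  obtain ⟨x₀, hx₀, hx₀l⟩ := hae2.exists
  set d : ℂ := (1 / x₀) • u x₀ - ∫ s in (1 : ℝ)..x₀, quotDeriv h s with hd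
  -- Convergence in L²_ρ says nothing about the point 1 itself. Convergence at a single good point
  -- `x₀`, with that of the integrals, determines the limit of the constants.
  have hdlim : Tendsto (fun i => φ (ns i) 1) atTop (𝓝 d) := by
    refine ((hx₀l.const_smul (1 / x₀)).sub (hFlim x₀ hx₀)).congr fun i => ?_
    rw [testFunction_div_eq (φ (ns i)) (hnae (ns i)) hx₀]
    abel
  refine ⟨fun y => d + ∫ s in (1 : ℝ)..y, quotDeriv h s, fun y hy => ?_, ?_⟩
  · refine HasDerivAt.const_add d ?_
    have hcont := continuousOn_quotDeriv h
    exact intervalIntegral.integral_hasDerivAt_right (intervalIntegrable_quotDeriv h hy)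
      (hcont.stronglyMeasurableAtFilter isOpen_Ioi y hy) (hcont.continuousAt (Ioi_mem_nhds hy))
  · rw [EventuallyEq, ae_rhoMeasure_iff]
    filter_upwards [hae2] with y hy
    have h1 : Tendsto (fun i => (1 / y) • φ (ns i) y) atTop
        (𝓝 (d + ∫ s in (1 : ℝ)..y, quotDeriv h s)) := by
      refine (hdlim.add (hFlim y hy.1)).congr fun i => ?_
      rw [testFunction_div_eq (φ (ns i)) (hnae (ns i)) hy.1]
    rw [← tendsto_nhds_unique (hy.2.const_smul (1 / y)) h1, smul_smul, mul_one_div_cancel hy.1.ne',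
      one_smul]

end Flux

/-! ### Simplicity of the eigenvalues by the Wronskian. -/

section Simplicity

/-- `v' = -P/σ`, `P' = σ q v` on the half-line, where `σ = y² ρ`. -/
def IsSystemSolution (q : ℝ → ℂ) (v P : ℝ → ℂ) : Prop :=
  ∀ y, 0 < y → HasDerivAt v (-((1 / (y ^ 2 * rho y)) • P y)) y ∧
    HasDerivAt P ((y ^ 2 * rho y) • (q y * v y)) y

theorem IsSystemSolution.sub_mul {q v P v' P' : ℝ → ℂ} (h : IsSystemSolution q v P)
    (h' : IsSystemSolution q v' P') (a : ℂ) :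
    IsSystemSolution q (fun y => v' y - a * v y) (fun y => P' y - a * P y) := by
  intro y hy
  refine ⟨((h' y hy).1.sub ((h y hy).1.const_mul a)).congr_deriv ?_,
    ((h' y hy).2.sub ((h y hy).2.const_mul a)).congr_deriv ?_⟩ <;>
  · simp only [Complex.real_smul]; ring

/-- The system is singular at 0, but on a compact interval of (0, ∞) around y and 1 its coefficients
are bounded, so the Lipschitz uniqueness theorem applies. -/
theorem IsSystemSolution.eq_zero {q v P : ℝ → ℂ} (hq : ContinuousOn q (Ioi 0))
    (h : IsSystemSolution q v P) (hv : v 1 = 0) (hP : P 1 = 0) {y : ℝ} (hy : 0 < y) :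
    v y = 0 := by
  set a := min y 1 / 2 with ha
  set b := max y 1 + 1 with hb
  have ha0 : 0 < a := half_pos (lt_min hy one_pos)
  have hay : a < min y 1 := half_lt_self (lt_min hy one_pos)
  have hyab : y ∈ Ioo a b :=
    ⟨hay.trans_le (min_le_left _ _), (le_max_left y 1).trans_lt (lt_add_one _)⟩
  have h1ab : (1 : ℝ) ∈ Ioo a b :=
    ⟨hay.trans_le (min_le_right _ _), (le_max_right y 1).trans_lt (lt_add_one _)⟩
  have hsub : Icc a b ⊆ Ioi 0 := fun t ht => lt_of_lt_of_le ha0 ht.1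
  have hσ : Continuous fun t : ℝ => t ^ 2 * rho t := by
    have := continuous_rho
    fun_prop
  have hσ0 : ∀ t ∈ Icc a b, t ^ 2 * rho t ≠ 0 := fun t ht =>
    (mul_pos (pow_pos (hsub ht) 2) (rho_pos (hsub ht))).ne'
  obtain ⟨K₁, hK₁⟩ := isCompact_Icc.exists_bound_of_continuousOn
    (continuousOn_const.div hσ.continuousOn hσ0 : ContinuousOn (fun t : ℝ =>
      1 / (t ^ 2 * rho t)) (Icc a b))
  obtain ⟨K₂, hK₂⟩ := isCompact_Icc.exists_bound_of_continuousOn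
    (hσ.continuousOn.smul (hq.mono hsub) : ContinuousOn (fun t : ℝ =>
      (t ^ 2 * rho t) • q t) (Icc a b))
  let V : ℝ → ℂ × ℂ → ℂ × ℂ := fun t p =>
    (-((1 / (t ^ 2 * rho t)) • p.2), (t ^ 2 * rho t) • (q t * p.1))
  have hLip : ∀ t ∈ Ioo a b, LipschitzOnWith (Real.toNNReal (max K₁ K₂)) (V t) univ := by
    intro t ht
    have ht' := Ioo_subset_Icc_self ht
    refine (LipschitzWith.of_dist_le' (K := max K₁ K₂) fun p p' => ?_).lipschitzOnWith
    rw [dist_eq_norm, dist_eq_norm]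
    have e : V t p - V t p' = (-((1 / (t ^ 2 * rho t)) • (p - p').2),
        ((t ^ 2 * rho t) • q t) * (p - p').1) := by
      refine Prod.ext ?_ ?_
      · simp only [V, Prod.fst_sub, Prod.snd_sub, smul_sub]; abel
      · simp only [V, Prod.fst_sub, Prod.snd_sub, Complex.real_smul]; ring
    rw [e, Prod.norm_def]
    refine max_le ?_ ?_
    · rw [norm_neg, norm_smul]
      exact mul_le_mul ((hK₁ t ht').trans (le_max_left _ _)) (norm_snd_le _) (norm_nonneg _)
        ((norm_nonneg _).trans ((hK₁ t ht').trans (le_max_left _ _)))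
    · rw [norm_mul]
      exact mul_le_mul ((hK₂ t ht').trans (le_max_right _ _)) (norm_fst_le _) (norm_nonneg _)
        ((norm_nonneg _).trans ((hK₂ t ht').trans (le_max_right _ _)))
  have huniq := ODE_solution_unique_of_mem_Ioo (s := fun _ => univ) hLip h1ab
    (f := fun t => (v t, P t)) (g := fun _ => (0, 0))
    (fun t ht => ⟨(h t (hsub (Ioo_subset_Icc_self ht))).1.prodMk
      (h t (hsub (Ioo_subset_Icc_self ht))).2, mem_univ _⟩)
    (fun t _ => ⟨(hasDerivAt_const t ((0 : ℂ), (0 : ℂ))).congr_deriv (by simp [V]; rfl), mem_univ _⟩)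
    (by simp [hv, hP])
  exact congrArg Prod.fst (huniq hyab)

/-- The Wronskian of two solutions is constant. -/
theorem IsSystemSolution.wronskian_eq {q v P v' P' : ℝ → ℂ} (h : IsSystemSolution q v P)
    (h' : IsSystemSolution q v' P') {y : ℝ} (hy : 0 < y) :
    v y * P' y - v' y * P y = v 1 * P' 1 - v' 1 * P 1 := by
  have hd : ∀ t ∈ Ioi (0 : ℝ), HasDerivAt (fun y => v y * P' y - v' y * P y) 0 t := by
    intro t ht
    refine (((h t ht).1.mul (h' t ht).2).sub ((h' t ht).1.mul (h t ht).2)).congr_deriv ?_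
    simp only [Complex.real_smul]
    ring
  exact isOpen_Ioi.is_const_of_deriv_eq_zero (convex_Ioi 0).isPreconnected
    (fun t ht => (hd t ht).differentiableAt.differentiableWithinAt)
    (fun t ht => (hd t ht).deriv) hy (mem_Ioi.2 one_pos)

/-- Two solutions in `L²_ρ` with small fluxes at the origin have vanishing Wronskian. -/
theorem IsSystemSolution.wronskian_eq_zero {q v P v' P' : ℝ → ℂ} (h : IsSystemSolution q v P)
    (h' : IsSystemSolution q v' P') {C : ℝ} (hP : ∀ y, 0 < y → ‖P y‖ ^ 2 ≤ y ^ 5 * C)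
    (hP' : ∀ y, 0 < y → ‖P' y‖ ^ 2 ≤ y ^ 5 * C) {u u' : WeightedL2}
    (hu : u =ᵐ[rhoMeasure] fun y => y • v y) (hu' : u' =ᵐ[rhoMeasure] fun y => y • v' y) :
    v 1 * P' 1 - v' 1 * P 1 = 0 := by
  by_contra hw
  set w := v 1 * P' 1 - v' 1 * P 1 with hwdef
  have hwpos : 0 < ‖w‖ ^ 2 := by positivity
  have hlow : ∀ y, 0 < y → ‖w‖ ^ 2 ≤ 2 * y ^ 5 * C * (‖v y‖ ^ 2 + ‖v' y‖ ^ 2) := by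
    intro y hy
    rw [hwdef, ← h.wronskian_eq h' hy]
    have h1 : ‖v y * P' y - v' y * P y‖ ≤ ‖v y‖ * ‖P' y‖ + ‖v' y‖ * ‖P y‖ := by
      rw [← norm_mul, ← norm_mul]; exact norm_sub_le _ _
    have h2 := pow_le_pow_left₀ (norm_nonneg _) h1 2
    have h3 := mul_le_mul_of_nonneg_left (hP' y hy) (sq_nonneg ‖v y‖)
    have h4 := mul_le_mul_of_nonneg_left (hP y hy) (sq_nonneg ‖v' y‖)
    nlinarith [sq_nonneg (‖v y‖ * ‖P' y‖ - ‖v' y‖ * ‖P y‖)]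
  have hi : Integrable (fun y => ‖u y‖ ^ 2 + ‖u' y‖ ^ 2) rhoMeasure :=
    (Lp.memLp u).integrable_norm_pow (by simp) |>.add
      ((Lp.memLp u').integrable_norm_pow (by simp))
  have hi2 : IntegrableOn (fun y => rho y • (‖u y‖ ^ 2 + ‖u' y‖ ^ 2)) (Ioc 0 1) :=
    (integrable_rhoMeasure_iff.1 hi).mono_set fun y hy => hy.1
  have hi3 := hi2.const_mul (2 * C * Real.exp (1 / 4) / ‖w‖ ^ 2)
  -- With u = y v, the lower bound `hlow` says that 1/y is at most a constant times ρ(‖u‖² + ‖u'‖²)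
  -- on (0, 1]; the factor exp(1/4) offsets the Gaussian there. The right side is integrable and 1/y
  -- is not.
  have hinv : IntervalIntegrable (fun y : ℝ => y⁻¹) volume 0 1 := by
    rw [intervalIntegrable_iff_integrableOn_Ioc_of_le zero_le_one]
    refine Integrable.mono hi3 (by fun_prop) ?_
    rw [ae_restrict_iff' measurableSet_Ioc]
    filter_upwards [(ae_restrict_iff' measurableSet_Ioi).1 (ae_rhoMeasure_iff.1 hu),
      (ae_restrict_iff' measurableSet_Ioi).1 (ae_rhoMeasure_iff.1 hu')] with y h1 h2 hy
    have hy0 : 0 < y := hy.1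
    rw [Real.norm_of_nonneg (inv_pos.2 hy0).le, h1 hy0, h2 hy0]
    refine le_trans ?_ (le_abs_self _)
    rw [norm_smul, norm_smul, Real.norm_of_nonneg hy0.le, smul_eq_mul, mul_pow, mul_pow, ← mul_add]
    have hl := hlow y hy0
    set s := ‖v y‖ ^ 2 + ‖v' y‖ ^ 2
    have hexp : 1 ≤ Real.exp (1 / 4) * Real.exp (-(y ^ 2 / 4)) := by
      rw [← Real.exp_add]
      refine Real.one_le_exp ?_
      nlinarith [hy.2]
    have e : 2 * C * Real.exp (1 / 4) / ‖w‖ ^ 2 * (rho y * (y ^ 2 * s)) =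
        y⁻¹ * ((2 * y ^ 5 * C * s) / ‖w‖ ^ 2 *
          (Real.exp (1 / 4) * Real.exp (-(y ^ 2 / 4)))) := by
      rw [rho]
      field_simp
    rw [e]
    have h5 : 1 ≤ (2 * y ^ 5 * C * s) / ‖w‖ ^ 2 := (one_le_div hwpos).2 hl
    have h6 := one_le_mul_of_one_le_of_one_le h5 hexp
    calc y⁻¹ = y⁻¹ * 1 := (mul_one _).symm
      _ ≤ _ := mul_le_mul_of_nonneg_left h6 (inv_pos.2 hy0).le
  rw [intervalIntegrable_inv_iff] at hinv
  simp at hinv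

/-- An eigenvector of the closure comes from a solution of the first order system. -/
theorem exists_systemSolution {f : ℝ → ℝ} (hf : IsSelfSimilarProfile f) {z : ℂ} {u : WeightedL2}
    (hu : u ∈ UnboundedOp.eigenspace (opA f hf).closure z) :
    ∃ v P : ℝ → ℂ, ∃ C : ℝ,
      IsSystemSolution (fun y => z - 1 / 2 - boundedPotential f y) v P ∧
      (∀ y, 0 < y → ‖P y‖ ^ 2 ≤ y ^ 5 * C) ∧ u =ᵐ[rhoMeasure] fun y => y • v y := by
  obtain ⟨B, hB⟩ := hf.exists_boundedPotential_le
  obtain ⟨W, hW⟩ := exists_mul_clm (aestronglyMeasurable_rhoMeasure_of_continuousOn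
    hf.continuousOn_boundedPotential) hB
  obtain ⟨hmem, hz⟩ := (UnboundedOp.mem_eigenspace_iff _ _ _).1 hu
  have hug : (u, z • u) ∈ closure ((opA f hf).graph : Set (WeightedL2 × WeightedL2)) := by
    rw [← Submodule.topologicalClosure_coe, (UnboundedOp.isClosable_of_symmetric
      (dense_domain_opA hf) (opA_isFormalAdjoint f hf)).graph_closure_eq_closure_graph]
    exact (LinearPMap.mem_graph_iff _).2 ⟨⟨u, hmem⟩, rfl, hz⟩
  obtain ⟨v, hv, huv⟩ := exists_regular_representative hf hW hug
  set h : WeightedL2 := z • u - W u - (1 / 2 : ℂ) • u with hh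
  set q : ℝ → ℂ := fun y => z - 1 / 2 - boundedPotential f y with hq
  have hae : h =ᵐ[rhoMeasure] fun y => y • (q y * v y) := by
    filter_upwards [Lp.coeFn_sub (z • u - W u) ((1 / 2 : ℂ) • u), Lp.coeFn_sub (z • u) (W u),
      Lp.coeFn_smul z u, Lp.coeFn_smul (1 / 2 : ℂ) u, hW u, huv] with y e1 e2 e3 e4 e5 e6
    rw [hh, e1, Pi.sub_apply, e2, Pi.sub_apply, e3, e4, Pi.smul_apply, Pi.smul_apply, e5, e6]
    simp only [hq, Complex.real_smul, smul_eq_mul]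
    ring
  have hqc : ContinuousOn q (Ioi 0) :=
    continuousOn_const.sub (Complex.continuous_ofReal.comp_continuousOn
      hf.continuousOn_boundedPotential)
  have hvc : ContinuousOn v (Ioi 0) := fun y hy => (hv y hy).continuousAt.continuousWithinAt
  have hkc : ContinuousOn (fun t => (t * rho t) • (t • (q t * v t))) (Ioi 0) :=
    (continuous_id.mul continuous_rho).continuousOn.smul
      (continuous_id.continuousOn.smul (hqc.mul hvc))
  refine ⟨v, flux h, ‖h‖ ^ 2, fun y hy => ⟨hv y hy, ?_⟩, fun y hy => norm_flux_sq_le h hy, huv⟩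
  have hint : IntervalIntegrable (fun t => (t * rho t) • (t • (q t * v t))) volume 0 y := by
    rw [intervalIntegrable_iff_integrableOn_Ioc_of_le hy.le]
    refine ((integrable_fluxDensity h).integrableOn (s := Ioc 0 y)).congr_fun_ae ?_
    rw [EventuallyEq, ae_restrict_iff' measurableSet_Ioc]
    filter_upwards [(ae_restrict_iff' measurableSet_Ioi).1 (ae_rhoMeasure_iff.1 hae)] with t ht htx
    rw [indicator_of_mem (mem_Ioi.2 htx.1), ht htx.1]
  have hd := intervalIntegral.integral_hasDerivAt_right hint
    (hkc.stronglyMeasurableAtFilter isOpen_Ioi y hy) (hkc.continuousAt (Ioi_mem_nhds hy))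
  refine (hd.congr_of_eventuallyEq ?_).congr_deriv ?_
  · filter_upwards [Ioi_mem_nhds hy] with x hx
    exact flux_eq_of_ae hae hx
  · rw [smul_smul]; congr 1; ring

/-- Any two eigenvectors with the same eigenvalue are proportional. -/
theorem eigenvectors_proportional {f : ℝ → ℝ} (hf : IsSelfSimilarProfile f) {z : ℂ}
    {u u' : WeightedL2} (hu : u ∈ UnboundedOp.eigenspace (opA f hf).closure z)
    (hu' : u' ∈ UnboundedOp.eigenspace (opA f hf).closure z) (hu0 : u ≠ 0) :
    ∃ a : ℂ, a • u = u' := by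
  obtain ⟨v, P, C, hs, hP, huv⟩ := exists_systemSolution hf hu
  obtain ⟨v', P', C', hs', hP', huv'⟩ := exists_systemSolution hf hu'
  have hqc : ContinuousOn (fun y => z - 1 / 2 - (boundedPotential f y : ℂ)) (Ioi 0) :=
    continuousOn_const.sub (Complex.continuous_ofReal.comp_continuousOn
      hf.continuousOn_boundedPotential)
  have hw := hs.wronskian_eq_zero hs' (C := max C C')
    (fun y hy => (hP y hy).trans (by gcongr; exact le_max_left _ _))
    (fun y hy => (hP' y hy).trans (by gcongr; exact le_max_right _ _)) huv huv'
  have hne : v 1 ≠ 0 ∨ P 1 ≠ 0 := by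
    by_contra! hcon
    apply hu0
    rw [Lp.eq_zero_iff_ae_eq_zero]
    filter_upwards [huv, ae_rhoMeasure_mem] with y h1 hy
    rw [h1, hs.eq_zero hqc hcon.1 hcon.2 hy]
    simp
  -- A vanishing Wronskian makes the data at 1 proportional, and uniqueness spreads the
  -- proportionality over the half-line.
  obtain ⟨a, ha1, ha2⟩ : ∃ a : ℂ, v' 1 - a * v 1 = 0 ∧ P' 1 - a * P 1 = 0 := by
    rcases hne with h0 | h0
    · refine ⟨v' 1 / v 1, by field_simp; ring, ?_⟩
      field_simp
      linear_combination hw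
    · refine ⟨P' 1 / P 1, ?_, by field_simp; ring⟩
      field_simp
      linear_combination -hw
  refine ⟨a, Lp.ext ?_⟩
  filter_upwards [huv, huv', ae_rhoMeasure_mem, Lp.coeFn_smul a u] with y h1 h2 hy h3
  have h4 := (hs.sub_mul hs' a).eq_zero hqc ha1 ha2 hy
  rw [h3, Pi.smul_apply, h1, h2, sub_eq_zero.1 h4, smul_comm, smul_eq_mul]

end Simplicity

end HarmonicMapFlow

theorem mainTheorem4 (f₀ : ℝ → ℝ) (hf₀ : HarmonicMapFlow.IsSelfSimilarProfile f₀) :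
    UnboundedOp.IsEssentiallySelfAdjoint (HarmonicMapFlow.opA f₀ hf₀) ∧
    UnboundedOp.HasPurelyDiscreteSpectrum (HarmonicMapFlow.opA f₀ hf₀).closure ∧
    (UnboundedOp.spectrum (HarmonicMapFlow.opA f₀ hf₀).closure).Countable ∧
    (UnboundedOp.spectrum (HarmonicMapFlow.opA f₀ hf₀).closure).Infinite ∧
    (∀ z ∈ UnboundedOp.spectrum (HarmonicMapFlow.opA f₀ hf₀).closure,
      z.im = 0 ∧ UnboundedOp.IsSimpleEigenvalue (HarmonicMapFlow.opA f₀ hf₀).closure z) := by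
  have hd := HarmonicMapFlow.dense_domain_opA hf₀
  have hT := HarmonicMapFlow.opA_isFormalAdjoint f₀ hf₀
  have hcl := UnboundedOp.isClosable_of_symmetric hd hT
  obtain ⟨c, R, hK, hRG⟩ := HarmonicMapFlow.exists_compact_inverse hf₀
  have hR := UnboundedOp.isRightInverse_closure hcl hRG
  have hS := UnboundedOp.closure_isFormalAdjoint hd hT
  have hSd : Dense ((HarmonicMapFlow.opA f₀ hf₀).closure.domain : Set HarmonicMapFlow.WeightedL2) :=
    hd.mono (LinearPMap.le_closure _).1
  have hdisc := hR.hasPurelyDiscreteSpectrum hS hK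
  refine ⟨⟨hd, hT, hcl, hR.isSelfAdjoint hS hSd⟩, hdisc, hR.spectrum_countable hS hK,
    hR.spectrum_infinite hS hK HarmonicMapFlow.not_finiteDimensional_weightedL2, fun z hz =>
    ⟨hR.im_eq_zero hS hK hz, ?_⟩⟩
  obtain ⟨x, hx, hx0⟩ := Submodule.exists_mem_ne_zero_of_ne_bot (hdisc z hz).2.1
  refine finrank_eq_one_iff'.2 ⟨⟨x, hx⟩, by simpa using hx0, fun y => ?_⟩
  obtain ⟨a, ha⟩ := HarmonicMapFlow.eigenvectors_proportional hf₀ hx y.2 hx0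
  exact ⟨a, Subtype.ext ha⟩
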